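/- Let $d\ge 1$ and regard $\mathrm{O}(d)\subset\mathrm{U}(d)$ as the subgroup of real matrices. For $t\ge 0$, $M$ a linear operator on $(\mathbb{C}^d)^{\otimes t}$, and a finite set $\mathcal{V}\subset\mathrm{U}(d)$ with weight function $w:\mathcal{V}\to[0,1]$, $\sum_{V\in\mathcal{V}}w(V)=1$ (for example $w\equiv 1/|\mathcal{V}|$), put $$\mathcal{T}^{(t)}_{G}(M)=\int_{G}U^{\otimes t}M(U^{\otimes t})^\dagger\,\mathrm{d}U\quad(G=\mathrm{U}(d),\ \mathrm{O}(d)),\qquad \mathcal{F}^{(t)}_{\mathcal{V}}(M)=\sum_{V\in\mathcal{V}}w(V)\,V^{\otimes t}M(V^{\otimes t})^\dagger,$$ where $\mathrm{d}U$ is the normalized Haar measure of $G$. Write $\mathcal{A}\preceq\mathcal{B}$ if $\mathcal{B}-\mathcal{A}$ is completely positive. For real $\epsilon>0$, $(\mathcal{V},w)$ is an $\epsilon$-approximate unitary $t$-design if $(1-\epsilon)\mathcal{F}^{(t)}_{\mathcal{V}}\preceq\mathcal{T}^{(t)}_{\mathrm{U}(d)}\preceq(1+\epsilon)\mathcal{F}^{(t)}_{\mathcal{V}}$,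 and an $\epsilon$-approximate orthogonal $t$-design if $\mathcal{V}\subset\mathrm{O}(d)$ and the same holds with $\mathcal{T}^{(t)}_{\mathrm{O}(d)}$ in place of $\mathcal{T}^{(t)}_{\mathrm{U}(d)}$. Let $|\psi\rangle=d^{-1/2}\sum_{j=0}^{d-1}|j\rangle\otimes|j\rangle$ and $P_{\mathrm t}=|\psi\rangle\langle\psi|$, and consider for $W\in\mathrm{U}(d)$ the condition $$\operatorname{Tr}\bigl(W^{\otimes2}P_{\mathrm t}(W^{\otimes2})^\dagger P_{\mathrm t}\bigr)=\frac{2}{d(d+1)}.\qquad(*)$$ (i) There is $\alpha\in[0,1]$ with $\bigl|\sum_{j=0}^{d-1}\omega_{2d}^{2\alpha j}\bigr|^2=\frac{2d}{d+1}$, where $\omega_{2d}^{x}=e^{2\pi i x/(2d)}$; and for every real $\alpha$ satisfying this equation the diagonal unitary $W|j\rangle=\omega_{2d}^{j\alpha}|j\rangle$, $j=0,\dots,d-1$, satisfies $(*)$. (ii) Let $W\in\mathrm{U}(d)$ be any unitary satisfying $(*)$, let $t\le 3$ and $\epsilon>0$, and let $(\mathcal{V},w)$ be an $\epsilon$-approximate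 orthogonal $t$-design. Then $\mathcal{V}^W\cdot\mathcal{V}=\{WAW^\dagger B: A,B\in\mathcal{V}\}$, with weight function $$U\mapsto\sum_{(A,B)\in\mathcal{V}\times\mathcal{V},\ WAW^\dagger B=U}w(A)\,w(B),$$ is a $(2\epsilon+\epsilon^2)$-approximate unitary $t$-design. -/

import Mathlib

open MeasureTheory
open scoped CStarAlgebra MatrixOrder Matrix Matrix.Norms.L2Operator Pointwise

noncomputable section

namespace OrthoDesign

/-! ### The groups `U(d)` and `O(d)` and their topology -/

/-- The unitary group `U(d)`. -/
abbrev UGrp (d : ℕ) : Type := Matrix.unitaryGroup (Fin d) ℂ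

/-- The (real) orthogonal group `O(d)`. -/
abbrev OGrp (d : ℕ) : Type := Matrix.orthogonalGroup (Fin d) ℝ

instance instMeasurableSpaceUGrp (d : ℕ) : MeasurableSpace (UGrp d) := borel _

instance instBorelSpaceUGrp (d : ℕ) : BorelSpace (UGrp d) := ⟨rfl⟩

instance instMeasurableSpaceOGrp (d : ℕ) : MeasurableSpace (OGrp d) := borel _

instance instBorelSpaceOGrp (d : ℕ) : BorelSpace (OGrp d) := ⟨rfl⟩

instance instCompactSpaceUGrp (d : ℕ) : CompactSpace (UGrp d) := by
  have hc : IsClosed {A : Matrix (Fin d) (Fin d) ℂ | A * star A = 1} :=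
    isClosed_eq (continuous_id.mul continuous_id.star) continuous_const
  have hs : {A : Matrix (Fin d) (Fin d) ℂ | A * star A = 1} ⊆
      Set.pi Set.univ fun _ => Set.pi Set.univ fun _ => Metric.closedBall (0 : ℂ) 1 := by
    intro A hA i _ j _
    simpa using entry_norm_bound_of_unitary (Matrix.mem_unitaryGroup_iff.2 hA) i j
  have hk : IsCompact {A : Matrix (Fin d) (Fin d) ℂ | A * star A = 1} :=
    IsCompact.of_isClosed_subset
      (isCompact_univ_pi fun _ => isCompact_univ_pi fun _ => isCompact_closedBall (0 : ℂ) 1) hc hs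
  refine (isCompact_iff_compactSpace (s := (Matrix.unitaryGroup (Fin d) ℂ : Set (Matrix (Fin d) (Fin d) ℂ)))).1 ?_
  convert hk using 1
  ext A
  exact Matrix.mem_unitaryGroup_iff

instance instCompactSpaceOGrp (d : ℕ) : CompactSpace (OGrp d) := by
  have hc : IsClosed {A : Matrix (Fin d) (Fin d) ℝ | A * Aᵀ = 1} :=
    isClosed_eq (continuous_id.mul continuous_id.matrix_transpose) continuous_const
  have hs : {A : Matrix (Fin d) (Fin d) ℝ | A * Aᵀ = 1} ⊆
      Set.pi Set.univ fun _ => Set.pi Set.univ fun _ => Metric.closedBall (0 : ℝ) 1 := by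
    intro A hA i _ j _
    have hA' : A ∈ Matrix.unitaryGroup (Fin d) ℝ := by
      rw [Matrix.mem_unitaryGroup_iff, Matrix.star_eq_conjTranspose,
        Matrix.conjTranspose_eq_transpose_of_trivial]
      exact hA
    simpa using entry_norm_bound_of_unitary hA' i j
  have hk : IsCompact {A : Matrix (Fin d) (Fin d) ℝ | A * Aᵀ = 1} :=
    IsCompact.of_isClosed_subset
      (isCompact_univ_pi fun _ => isCompact_univ_pi fun _ => isCompact_closedBall (0 : ℝ) 1) hc hs
  refine (isCompact_iff_compactSpace (s := (Matrix.orthogonalGroup (Fin d) ℝ : Set (Matrix (Fin d) (Fin d) ℝ)))).1 ?_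
  convert hk using 1
  ext A
  exact Matrix.mem_orthogonalGroup_iff (Fin d) ℝ

/-- The embedding `O(d) → U(d)` reading a real matrix as a complex one. -/
def complexify (d : ℕ) : OGrp d →ₜ* UGrp d where
  toFun A := ⟨A.1.map Complex.ofReal, by
    rw [Matrix.mem_unitaryGroup_iff, Matrix.star_eq_conjTranspose]
    have h := (Matrix.mem_orthogonalGroup_iff (Fin d) ℝ).1 A.2
    have h2 : (A.1.map Complex.ofReal)ᴴ = (A.1ᵀ).map Complex.ofReal := by
      ext i j
      simp
    have h3 := congrArg (fun B => Complex.ofRealHom.mapMatrix B) h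
    simp only [map_mul, map_one] at h3
    rw [h2]
    exact h3⟩
  map_one' := by
    refine Subtype.ext ?_
    exact map_one (Complex.ofRealHom.mapMatrix (m := Fin d))
  map_mul' A B := by
    refine Subtype.ext ?_
    exact map_mul (Complex.ofRealHom.mapMatrix (m := Fin d)) A.1 B.1
  continuous_toFun := by
    refine Continuous.subtype_mk ?_ _
    exact continuous_subtype_val.matrix_map Complex.continuous_ofReal

/-! ### Tensor powers, twirls, complete positivity -/

/-- Matrices of linear operators on `(ℂ^d)^{⊗t}` in the product basis. -/
abbrev TMat (d t : ℕ) : Type := Matrix (Fin t → Fin d) (Fin t → Fin d) ℂ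

/-- The `t`-fold tensor (Kronecker) power `A^{⊗t}`. -/
def tpow {d : ℕ} (t : ℕ) (A : Matrix (Fin d) (Fin d) ℂ) : TMat d t :=
  Matrix.of fun i j => ∏ k, A (i k) (j k)

/-- The map `M ↦ A M A†`. -/
def conjMap {d t : ℕ} (A : TMat d t) : TMat d t →ₗ[ℂ] TMat d t where
  toFun M := A * M * Aᴴ
  map_add' M N := by rw [mul_add, add_mul]
  map_smul' c M := by simp

/-- Normalized Haar (probability) measure of a compact group. -/
def haarProb (G : Type) [Group G] [TopologicalSpace G] [IsTopologicalGroup G] [CompactSpace G]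
    [MeasurableSpace G] [BorelSpace G] : Measure G :=
  Measure.haarMeasure ⊤

theorem integrable_conjMap {d t : ℕ} {G : Type} [Group G] [TopologicalSpace G]
    [IsTopologicalGroup G] [CompactSpace G] [MeasurableSpace G] [BorelSpace G]
    (ρ : G →ₜ* UGrp d) (M : TMat d t) :
    Integrable (fun g => conjMap (tpow t (ρ g).1) M) (haarProb G) := by
  have h1 : Continuous fun g => (ρ g).1 := continuous_subtype_val.comp ρ.continuous_toFun
  have h2 : Continuous fun g => tpow t (ρ g).1 :=
    continuous_matrix fun i j => by
      simp only [tpow, Matrix.of_apply]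
      exact continuous_finsetProd _ fun k _ => h1.matrix_elem _ _
  have h3 : Continuous fun g => conjMap (tpow t (ρ g).1) M :=
    (h2.mul continuous_const).mul h2.matrix_conjTranspose
  have : IsFiniteMeasure (haarProb G) := by unfold haarProb; infer_instance
  exact h3.integrable_of_hasCompactSupport (HasCompactSupport.of_compactSpace _)

/-- The `t`-fold twirl `M ↦ ∫_G ρ(g)^{⊗t} M (ρ(g)^{⊗t})† dg` over a compact group `G`
represented by `ρ : G → U(d)`, with respect to normalized Haar measure. -/
def twirl {d : ℕ} (t : ℕ) {G : Type} [Group G] [TopologicalSpace G]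
    [IsTopologicalGroup G] [CompactSpace G] [MeasurableSpace G] [BorelSpace G]
    (ρ : G →ₜ* UGrp d) : TMat d t →ₗ[ℂ] TMat d t where
  toFun M := ∫ g, conjMap (tpow t (ρ g).1) M ∂(haarProb G)
  map_add' M N := by
    simp only [map_add]
    exact integral_add (integrable_conjMap ρ M) (integrable_conjMap ρ N)
  map_smul' c M := by
    simp only [map_smul, RingHom.id_apply]
    exact integral_smul c _

/-- The twirl `𝒯_{U(d)}^{(t)}`. -/
def unitaryTwirl (d t : ℕ) : TMat d t →ₗ[ℂ] TMat d t :=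
  twirl t (ContinuousMonoidHom.id (UGrp d))

/-- The twirl `𝒯_{O(d)}^{(t)}`. -/
def orthogonalTwirl (d t : ℕ) : TMat d t →ₗ[ℂ] TMat d t :=
  twirl t (complexify d)

/-- The discrete twirl `ℱ_𝒱^{(t)}(M) = ∑_{U ∈ 𝒱} w(U) U^{⊗t} M (U^{⊗t})†`. -/
def finiteTwirl {d : ℕ} (t : ℕ) (V : Finset (UGrp d)) (w : UGrp d → ℝ) :
    TMat d t →ₗ[ℂ] TMat d t :=
  ∑ U ∈ V, (w U : ℂ) • conjMap (tpow t U.1)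

/-- `A ⪯ B`: the difference `B - A` is a completely positive map. -/
def CPLE {d t : ℕ} (A B : TMat d t →ₗ[ℂ] TMat d t) : Prop :=
  ∃ Φ : TMat d t →CP TMat d t, Φ.toLinearMap = B - A

/-! ### Approximate designs -/

/-- `w` is a (normalized) weight function on the finite set `V`; only its values on `V` matter. -/
def IsWeight {d : ℕ} (V : Finset (UGrp d)) (w : UGrp d → ℝ) : Prop :=
  (∀ U ∈ V, 0 ≤ w U) ∧ ∑ U ∈ V, w U = 1

/-- `(V, w)` is an `ε`-approximate unitary `t`-design (in relative error). -/
structure IsApproxUnitaryDesign {d : ℕ} (t : ℕ) (ε : ℝ) (V : Finset (UGrp d))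
    (w : UGrp d → ℝ) : Prop where
  weight : IsWeight V w
  lower : CPLE (((1 - ε : ℝ) : ℂ) • finiteTwirl t V w) (unitaryTwirl d t)
  upper : CPLE (unitaryTwirl d t) (((1 + ε : ℝ) : ℂ) • finiteTwirl t V w)

/-- `(V, w)`, with `V` a finite subset of `O(d) ⊂ U(d)`, is an `ε`-approximate orthogonal
`t`-design (in relative error). -/
structure IsApproxOrthogonalDesign {d : ℕ} (t : ℕ) (ε : ℝ) (V : Finset (UGrp d))
    (w : UGrp d → ℝ) : Prop where
  orthogonal : (V : Set (UGrp d)) ⊆ Set.range (complexify d)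
  weight : IsWeight V w
  lower : CPLE (((1 - ε : ℝ) : ℂ) • finiteTwirl t V w) (orthogonalTwirl d t)
  upper : CPLE (orthogonalTwirl d t) (((1 + ε : ℝ) : ℂ) • finiteTwirl t V w)

/-! ### Products and conjugates of weighted sets -/

open Classical in
/-- The conjugated set `V^W = {W U W† : U ∈ V}`. -/
def conjSet {d : ℕ} (W : UGrp d) (V : Finset (UGrp d)) : Finset (UGrp d) :=
  V.image fun U => W * U * W⁻¹

/-- The weight on `V^W` carried over from `V`. -/
def conjWeight {d : ℕ} (W : UGrp d) (w : UGrp d → ℝ) : UGrp d → ℝ :=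
  fun U => w (W⁻¹ * U * W)

open Classical in
/-- The product set `A · B = {a b : a ∈ A, b ∈ B}`. -/
def mulSet {d : ℕ} (A B : Finset (UGrp d)) : Finset (UGrp d) := A * B

open Classical in
/-- The weight on `A · B`: the total weight of all factorizations. For uniform weights on `A` and
`B` it is `#{(a, b) ∈ A × B : a b = U} / (#A #B)`. -/
def mulWeight {d : ℕ} (A B : Finset (UGrp d)) (wA wB : UGrp d → ℝ) : UGrp d → ℝ :=
  fun U => ∑ p ∈ A ×ˢ B with p.1 * p.2 = U, wA p.1 * wB p.2

/-! ### The rotating unitary -/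

/-- The maximally entangled vector `|ψ⟩ = d^{-1/2} ∑_j |j⟩ ⊗ |j⟩`. -/
def bellVec (d : ℕ) : (Fin 2 → Fin d) → ℂ :=
  fun i => if i 0 = i 1 then ((1 / Real.sqrt d : ℝ) : ℂ) else 0

/-- The projection `P_t = |ψ⟩⟨ψ|`. -/
def bellProj (d : ℕ) : TMat d 2 := Matrix.vecMulVec (bellVec d) (star (bellVec d))

/-- The condition `Tr(P_t^{W^{⊗2}} P_t) = 2 / (d (d + 1))`, where
`P_t^{W^{⊗2}} = W^{⊗2} P_t (W^{⊗2})†`. -/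
def HasBellOverlap {d : ℕ} (W : UGrp d) : Prop :=
  (conjMap (tpow 2 W.1) (bellProj d) * bellProj d).trace = 2 / ((d : ℂ) * ((d : ℂ) + 1))

/-- `ω_{2d}^x = exp(2πi x / (2d))` for real `x`. -/
def omegaPow (d : ℕ) (x : ℝ) : ℂ := Complex.exp (((2 * Real.pi * x / (2 * d) : ℝ) : ℂ) * Complex.I)

/-- The diagonal unitary `W_α |j⟩ = ω_{2d}^{jα} |j⟩`, `j = 0, …, d-1`. -/
def diagW (d : ℕ) (α : ℝ) : UGrp d :=
  ⟨Matrix.diagonal fun j : Fin d => omegaPow d ((j : ℕ) * α), by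
    rw [Matrix.mem_unitaryGroup_iff, Matrix.star_eq_conjTranspose, Matrix.diagonal_conjTranspose,
      Matrix.diagonal_mul_diagonal, ← Matrix.diagonal_one]
    congr 1
    funext j
    have h : ‖omegaPow d ((j : ℕ) * α)‖ = 1 := Complex.norm_exp_ofReal_mul_I _
    simp [Complex.mul_conj, Complex.normSq_eq_norm_sq, h]⟩

/-- `q(α) = |∑_j ω_{2d}^{2αj}|²`. -/
def qFun (d : ℕ) (α : ℝ) : ℝ := ‖∑ j : Fin d, omegaPow d (2 * α * (j : ℕ))‖ ^ 2

end OrthoDesign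

end

/-! The core is an exact identity: for `t ≤ 3`, twirling over `O(d)` and then over `W O(d) W†`
equals twirling over `U(d)`. The unitary twirl absorbs both orthogonal twirls, so it is enough that
the composite takes values in the commutant of the unitaries
(`rotatedTwirl_comp_orthogonalTwirl_of_fixed`).

The orthogonal twirl lands in the commutant of `O(d)`, which is spanned by Brauer diagrams
(`mem_span_pairMat`). A diagram on 3 + 3 points is either a permutation, which commutes with every
`U^{⊗3}`, or has exactly one contraction on each side. In the second case it is `F ⊗ 1` up to
permuting factors, with `F = d P_t` (`pairMat_three`). The rotated twirl of `F` is therefore a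
degree-two question: symmetry, trace and the overlap with `F` determine it, and condition (*) is
exactly what cancels its non-unitary component (`rotatedTwirl_pairF`). Lower degrees follow by
tensoring with the identity.

The spanning statement is the first fundamental theorem for `O(d)`, obtained from reflections,
coordinate permutations and infinitesimal rotations. If there are at least as many colors as pairs,
coefficients are read off at indices whose fibers are the pairs of one pairing. The case `d = 2`, `t
= 3` has too few colors and becomes a statement about perfect matchings of `K₆`; `d = 1` is trivial.

Approximate designs then follow by composing completely positive inequalities, with `(1 + ε)² = 1 +
2ε + ε²` (`CPLE_comp_bounds`). Existence of the angle is the intermediate value theorem for `qFun`,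
and for diagonal `W` the Bell overlap is `qFun / d²`. -/

noncomputable section

namespace OrthoDesign

/-! ### Tensor powers -/

section TensorPower

variable {d t : ℕ}

theorem tpow_mul (A B : Matrix (Fin d) (Fin d) ℂ) : tpow t (A * B) = tpow t A * tpow t B := by
  ext i j
  simp only [tpow, Matrix.of_apply, Matrix.mul_apply, Finset.prod_univ_sum, Fintype.piFinset_univ,
    Finset.prod_mul_distrib]

theorem tpow_one : tpow t (1 : Matrix (Fin d) (Fin d) ℂ) = 1 := by
  ext i j
  simp only [tpow, Matrix.of_apply, Matrix.one_apply, Finset.prod_ite_zero, Finset.prod_const_one,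
    Finset.mem_univ, true_imp_iff, funext_iff]

theorem tpow_conjTranspose (A : Matrix (Fin d) (Fin d) ℂ) : tpow t Aᴴ = (tpow t A)ᴴ := by
  ext i j
  simp [tpow]

/-- The conjugation `M ↦ U^{⊗t} M (U^{⊗t})†` by a unitary. -/
def conjU (t : ℕ) (U : UGrp d) : TMat d t →ₗ[ℂ] TMat d t := conjMap (tpow t U.1)

theorem conjU_apply (U : UGrp d) (M : TMat d t) :
    conjU t U M = tpow t U.1 * M * (tpow t U.1)ᴴ := rfl

theorem tpow_mul_conjTranspose (U : UGrp d) : tpow t U.1 * (tpow t U.1)ᴴ = 1 := by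
  rw [← tpow_conjTranspose, ← tpow_mul, ← Matrix.star_eq_conjTranspose,
    Matrix.mem_unitaryGroup_iff.1 U.2, tpow_one]

theorem conjTranspose_mul_tpow (U : UGrp d) : (tpow t U.1)ᴴ * tpow t U.1 = 1 := by
  rw [← tpow_conjTranspose, ← tpow_mul, ← Matrix.star_eq_conjTranspose,
    Matrix.mem_unitaryGroup_iff'.1 U.2, tpow_one]

theorem conjU_mul (U V : UGrp d) (M : TMat d t) : conjU t (U * V) M = conjU t U (conjU t V M) := by
  simp only [conjU_apply, Submonoid.coe_mul, tpow_mul, Matrix.conjTranspose_mul, Matrix.mul_assoc]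

theorem conjU_one (M : TMat d t) : conjU t (1 : UGrp d) M = M := by
  simp [conjU_apply, tpow_one]

theorem conjU_self_inv (U : UGrp d) (M : TMat d t) : conjU t U (conjU t U⁻¹ M) = M := by
  rw [← conjU_mul, mul_inv_cancel, conjU_one]

theorem conjU_id (U : UGrp d) : conjU t U 1 = 1 := by
  rw [conjU_apply, mul_one, tpow_mul_conjTranspose]

theorem conjU_mul_matrix (U : UGrp d) (M N : TMat d t) :
    conjU t U (M * N) = conjU t U M * conjU t U N := by
  have h := conjTranspose_mul_tpow (t := t) U
  simp only [conjU_apply]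
  calc _ = tpow t U.1 * M * 1 * N * (tpow t U.1)ᴴ := by simp only [Matrix.mul_assoc, one_mul]
    _ = _ := by rw [← h]; simp only [Matrix.mul_assoc]

theorem trace_conjU (U : UGrp d) (M : TMat d t) : (conjU t U M).trace = M.trace := by
  rw [conjU_apply, Matrix.trace_mul_comm, ← Matrix.mul_assoc, conjTranspose_mul_tpow, one_mul]

end TensorPower

/-! ### Twirls -/

section Twirl

variable {d t : ℕ} {G : Type} [Group G] [TopologicalSpace G] [IsTopologicalGroup G]
  [CompactSpace G] [MeasurableSpace G] [BorelSpace G]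

instance instIsProbabilityMeasureHaarProb : IsProbabilityMeasure (haarProb G) :=
  ⟨Measure.haarMeasure_self⟩

instance instIsHaarMeasureHaarProb : (haarProb G).IsHaarMeasure := by
  unfold haarProb
  infer_instance

/-- A right translate of Haar measure is again a left-invariant probability measure, and there is
only one. -/
instance instIsMulRightInvariantHaarProb : (haarProb G).IsMulRightInvariant where
  map_mul_right_eq_self g := by
    have : IsProbabilityMeasure (Measure.map (· * g) (haarProb G)) :=
      Measure.isProbabilityMeasure_map (by fun_prop)
    exact Measure.isHaarMeasure_eq_of_isProbabilityMeasure _ _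

variable (ρ : G →ₜ* UGrp d)

theorem twirl_apply (M : TMat d t) : twirl t ρ M = ∫ g, conjU t (ρ g) M ∂(haarProb G) := rfl

theorem map_twirl {E : Type*} [NormedAddCommGroup E] [NormedSpace ℂ E]
    [CompleteSpace E]
    (f : TMat d t →ₗ[ℂ] E) (M : TMat d t) :
    f (twirl t ρ M) = ∫ g, f (conjU t (ρ g) M) ∂(haarProb G) := by
  have := (LinearMap.toContinuousLinearMap f).integral_comp_comm (integrable_conjMap (t := t) ρ M)
  exact this.symm

/-- Transfers linear identities from an orbit to its average. It is applied to traces, to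
multiplication by a fixed operator, and to the unitary twirl itself. -/
theorem map_twirl_eq_of_forall {E : Type*} [NormedAddCommGroup E] [NormedSpace ℂ E] [CompleteSpace E]
    (f : TMat d t →ₗ[ℂ] E) (M : TMat d t) (c : E) (h : ∀ g, f (conjU t (ρ g) M) = c) :
    f (twirl t ρ M) = c := by
  rw [map_twirl, integral_congr_ae (Filter.Eventually.of_forall h), integral_const]
  simp

theorem twirl_eq_self (M : TMat d t) (h : ∀ g, conjU t (ρ g) M = M) : twirl t ρ M = M :=
  map_twirl_eq_of_forall ρ LinearMap.id M M h

theorem conjU_twirl (h : G) (M : TMat d t) : conjU t (ρ h) (twirl t ρ M) = twirl t ρ M := by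
  rw [map_twirl]
  simp only [← conjU_mul, ← map_mul]
  exact integral_mul_left_eq_self (μ := haarProb G) (fun g => conjU t (ρ g) M) h

theorem twirl_conjU (h : G) (M : TMat d t) : twirl t ρ (conjU t (ρ h) M) = twirl t ρ M := by
  simp only [twirl_apply, ← conjU_mul, ← map_mul]
  exact integral_mul_right_eq_self (μ := haarProb G) (fun g => conjU t (ρ g) M) h

/-- Linear maps that intertwine the conjugations intertwine the twirls. -/
theorem twirl_comm {s : ℕ} (f : TMat d s →ₗ[ℂ] TMat d t)
    (hf : ∀ U M, f (conjU s U M) = conjU t U (f M)) (M : TMat d s) :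
    f (twirl s ρ M) = twirl t ρ (f M) := by
  rw [map_twirl, twirl_apply]
  simp only [hf]

theorem unitaryTwirl_conjU (U : UGrp d) (M : TMat d t) :
    unitaryTwirl d t (conjU t U M) = unitaryTwirl d t M :=
  twirl_conjU (ContinuousMonoidHom.id (UGrp d)) U M

theorem unitaryTwirl_eq_self (M : TMat d t) (h : ∀ U, conjU t U M = M) : unitaryTwirl d t M = M :=
  twirl_eq_self (ContinuousMonoidHom.id (UGrp d)) M h

theorem unitaryTwirl_twirl (M : TMat d t) : unitaryTwirl d t (twirl t ρ M) = unitaryTwirl d t M :=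
  map_twirl_eq_of_forall ρ (unitaryTwirl d t) M _ fun g => unitaryTwirl_conjU (ρ g) M

/-- The twirl over `W O(d) W†`. -/
def rotatedTwirl (t : ℕ) (W : UGrp d) : TMat d t →ₗ[ℂ] TMat d t :=
  conjU t W ∘ₗ orthogonalTwirl d t ∘ₗ conjU t W⁻¹

theorem rotatedTwirl_apply (W : UGrp d) (M : TMat d t) :
    rotatedTwirl t W M = conjU t W (orthogonalTwirl d t (conjU t W⁻¹ M)) := rfl

theorem unitaryTwirl_rotatedTwirl (W : UGrp d) (M : TMat d t) :
    unitaryTwirl d t (rotatedTwirl t W M) = unitaryTwirl d t M := by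
  rw [rotatedTwirl_apply, unitaryTwirl_conjU, orthogonalTwirl, unitaryTwirl_twirl,
    unitaryTwirl_conjU]

theorem rotatedTwirl_comm {s : ℕ} (f : TMat d s →ₗ[ℂ] TMat d t)
    (hf : ∀ U M, f (conjU s U M) = conjU t U (f M)) (W : UGrp d) (M : TMat d s) :
    f (rotatedTwirl s W M) = rotatedTwirl t W (f M) := by
  rw [rotatedTwirl_apply, rotatedTwirl_apply, hf, orthogonalTwirl, twirl_comm _ f hf, hf]
  rfl

theorem rotatedTwirl_eq_self (W : UGrp d) (M : TMat d t) (h : ∀ U, conjU t U M = M) :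
    rotatedTwirl t W M = M := by
  rw [rotatedTwirl_apply, h, orthogonalTwirl, twirl_eq_self _ _ fun _ => h _, h]

/-- If `rotatedTwirl ∘ orthogonalTwirl` lands in the commutant of the unitaries, then it is
the unitary twirl. -/
theorem rotatedTwirl_comp_orthogonalTwirl_of_fixed (W : UGrp d)
    (h : ∀ (U : UGrp d) (M : TMat d t),
      conjU t U (rotatedTwirl t W (orthogonalTwirl d t M)) =
        rotatedTwirl t W (orthogonalTwirl d t M)) :
    rotatedTwirl t W ∘ₗ orthogonalTwirl d t = unitaryTwirl d t := by
  ext1 M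
  -- A fixed point of all unitaries equals its own unitary twirl, and that twirl absorbs both inner
  -- ones.
  rw [LinearMap.comp_apply, ← unitaryTwirl_eq_self _ fun U => h U M, unitaryTwirl_rotatedTwirl,
    orthogonalTwirl, unitaryTwirl_twirl]

end Twirl

/-! ### Completely positive maps -/

section CompletelyPositive

variable {d t : ℕ}

/-- Complete positivity as a predicate on linear maps. -/
def IsCP (f : TMat d t →ₗ[ℂ] TMat d t) : Prop :=
  ∀ (k : ℕ) (M : CStarMatrix (Fin k) (Fin k) (TMat d t)), 0 ≤ M → 0 ≤ M.map f

theorem CPLE_iff {f g : TMat d t →ₗ[ℂ] TMat d t} : CPLE f g ↔ IsCP (g - f) := by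
  constructor
  · rintro ⟨Φ, hΦ⟩ k M hM
    rw [← hΦ]
    exact Φ.map_cstarMatrix_nonneg' k M hM
  · intro h
    exact ⟨⟨g - f, h⟩, rfl⟩

theorem IsCP.comp {f g : TMat d t →ₗ[ℂ] TMat d t} (hf : IsCP f) (hg : IsCP g) :
    IsCP (f ∘ₗ g) := fun k M hM => hf k _ (hg k M hM)

theorem IsCP.add {f g : TMat d t →ₗ[ℂ] TMat d t} (hf : IsCP f) (hg : IsCP g) : IsCP (f + g) :=
  fun k M hM => add_nonneg (hf k M hM) (hg k M hM)

theorem IsCP.zero : IsCP (0 : TMat d t →ₗ[ℂ] TMat d t) := fun _ _ _ => le_rfl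

theorem IsCP.smul {f : TMat d t →ₗ[ℂ] TMat d t} (hf : IsCP f) {r : ℝ} (hr : 0 ≤ r) :
    IsCP ((r : ℂ) • f) := fun k M hM => by
  have : M.map ((r : ℂ) • f) = r • M.map f := by
    ext1 i j
    simp [CStarMatrix.map_apply]
  rw [this]
  exact smul_nonneg hr (hf k M hM)

theorem IsCP.sum {ι : Type*} (s : Finset ι) (f : ι → TMat d t →ₗ[ℂ] TMat d t)
    (hf : ∀ i ∈ s, IsCP (f i)) : IsCP (∑ i ∈ s, f i) := by
  classical
  induction s using Finset.induction_on with
  | empty => simpa using IsCP.zero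
  | insert a s ha ih =>
    rw [Finset.sum_insert ha]
    exact (hf _ (Finset.mem_insert_self _ _)).add
      (ih fun i hi => hf i (Finset.mem_insert_of_mem hi))

/-- Applied blockwise, the map is conjugation by the block-diagonal matrix with `A` in every
diagonal block. -/
theorem IsCP.conjMap (A : TMat d t) : IsCP (conjMap A) := fun k M hM => by
  have : M.map (OrthoDesign.conjMap A) =
      (CStarMatrix.ofMatrix (Matrix.diagonal fun _ => A)) * M *
        star (CStarMatrix.ofMatrix (Matrix.diagonal fun _ => A)) := by
    ext1 i j
    rw [CStarMatrix.map_apply, CStarMatrix.mul_apply]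
    simp only [CStarMatrix.mul_apply, CStarMatrix.star_apply, CStarMatrix.ofMatrix_apply,
      Matrix.diagonal_apply]
    simp [OrthoDesign.conjMap, Finset.sum_ite_eq, Matrix.star_eq_conjTranspose, apply_ite]
  rw [this]
  exact star_right_conjugate_nonneg hM _

theorem integral_nonneg_of_cstarAlgebra {A G : Type*} [NonUnitalCStarAlgebra A] [PartialOrder A]
    [StarOrderedRing A] [MeasurableSpace G] {μ : Measure G} {f : G → A} (hf : ∀ g, 0 ≤ f g) :
    0 ≤ ∫ g, f g ∂μ := by
  have : IsOrderedModule ℝ A := .of_smul_nonneg fun r hr x hx => smul_nonneg hr hx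
  have : OrderClosedTopology A := inferInstance
  exact integral_nonneg hf

theorem IsCP.twirl {G : Type} [Group G] [TopologicalSpace G] [IsTopologicalGroup G]
    [CompactSpace G] [MeasurableSpace G] [BorelSpace G] (ρ : G →ₜ* UGrp d) :
    IsCP (twirl t ρ) := fun k M hM => by
  have h1 : ∀ i j, Integrable (fun g => conjU t (ρ g) (M i j)) (haarProb G) :=
    fun i j => integrable_conjMap ρ (M i j)
  -- Placing a block at position `(i, j)` is linear on a finite-dimensional space, hence continuous,
  -- so the blockwise integral becomes one integral of positive block matrices.
  let ev (i j : Fin k) : TMat d t →ₗ[ℂ] CStarMatrix (Fin k) (Fin k) (TMat d t) :=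
    { toFun := fun A => CStarMatrix.ofMatrix (Matrix.single i j A)
      map_add' := fun A B => by rw [Matrix.single_add]; rfl
      map_smul' := fun c A => by rw [← Matrix.smul_single]; rfl }
  have h2 : ∀ f : TMat d t → TMat d t, M.map f = ∑ i, ∑ j, ev i j (f (M i j)) := by
    intro f
    exact Matrix.matrix_eq_sum_single _
  have h3 : M.map (OrthoDesign.twirl t ρ) = ∫ g, M.map (conjU t (ρ g)) ∂(haarProb G) := by
    simp only [h2]
    have h4 : ∀ i j, Integrable (fun g => ev i j (conjU t (ρ g) (M i j))) (haarProb G) := fun i j =>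
      (LinearMap.toContinuousLinearMap (ev i j)).integrable_comp (h1 i j)
    rw [integral_finsetSum _ fun i _ => integrable_finsetSum _ fun j _ => h4 i j]
    refine Finset.sum_congr rfl fun i _ => ?_
    rw [integral_finsetSum _ fun j _ => h4 i j]
    refine Finset.sum_congr rfl fun j _ => ?_
    exact map_twirl ρ (ev i j) (M i j)
  rw [h3]
  exact integral_nonneg_of_cstarAlgebra fun g => IsCP.conjMap _ k M hM

theorem IsCP.finiteTwirl {V : Finset (UGrp d)} {w : UGrp d → ℝ} (hw : ∀ U ∈ V, 0 ≤ w U) :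
    IsCP (finiteTwirl t V w) :=
  IsCP.sum _ _ fun U hU => (IsCP.conjMap _).smul (hw U hU)

end CompletelyPositive

/-! ### Products of approximate twirls -/

section Products

variable {d t : ℕ}

/-- Relative-error bounds compose. -/
theorem CPLE_comp_bounds {ε : ℝ} (hε : 0 < ε) {T₁ T₂ F₁ F₂ : TMat d t →ₗ[ℂ] TMat d t}
    (hT₁ : IsCP T₁) (hT₂ : IsCP T₂) (hF₁ : IsCP F₁) (hF₂ : IsCP F₂)
    (l₁ : CPLE (((1 - ε : ℝ) : ℂ) • F₁) T₁) (u₁ : CPLE T₁ (((1 + ε : ℝ) : ℂ) • F₁))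
    (l₂ : CPLE (((1 - ε : ℝ) : ℂ) • F₂) T₂) (u₂ : CPLE T₂ (((1 + ε : ℝ) : ℂ) • F₂)) :
    CPLE (((1 - (2 * ε + ε ^ 2) : ℝ) : ℂ) • (F₁ ∘ₗ F₂)) (T₁ ∘ₗ T₂) ∧
      CPLE (T₁ ∘ₗ T₂) (((1 + (2 * ε + ε ^ 2) : ℝ) : ℂ) • (F₁ ∘ₗ F₂)) := by
  rw [CPLE_iff] at *
  constructor
  -- For `ε ≤ 1` the factor `1 - ε` is a legitimate positive coefficient, and `(1 - ε)²` exceeds `1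
  -- - (2ε + ε²)` by `2ε²`. For `ε > 1` the coefficient `1 - (2ε + ε²)` is negative and the bound is
  -- immediate.
  · rcases le_or_gt ε 1 with h | h
    · have e : T₁ ∘ₗ T₂ - ((1 - (2 * ε + ε ^ 2) : ℝ) : ℂ) • (F₁ ∘ₗ F₂) =
          (T₁ - ((1 - ε : ℝ) : ℂ) • F₁) ∘ₗ T₂ +
            ((1 - ε : ℝ) : ℂ) • (F₁ ∘ₗ (T₂ - ((1 - ε : ℝ) : ℂ) • F₂)) +
              ((2 * ε ^ 2 : ℝ) : ℂ) • (F₁ ∘ₗ F₂) := by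
        simp only [LinearMap.sub_comp, LinearMap.comp_sub, LinearMap.smul_comp, LinearMap.comp_smul]
        push_cast
        module
      rw [e]
      exact ((l₁.comp hT₂).add ((hF₁.comp l₂).smul (by linarith))).add
        ((hF₁.comp hF₂).smul (by positivity))
    · have e : T₁ ∘ₗ T₂ - ((1 - (2 * ε + ε ^ 2) : ℝ) : ℂ) • (F₁ ∘ₗ F₂) =
          T₁ ∘ₗ T₂ + ((2 * ε + ε ^ 2 - 1 : ℝ) : ℂ) • (F₁ ∘ₗ F₂) := by
        push_cast
        module
      rw [e]
      exact (hT₁.comp hT₂).add ((hF₁.comp hF₂).smul (by nlinarith))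
  · have e : ((1 + (2 * ε + ε ^ 2) : ℝ) : ℂ) • (F₁ ∘ₗ F₂) - T₁ ∘ₗ T₂ =
        ((1 + ε : ℝ) : ℂ) • (F₁ ∘ₗ (((1 + ε : ℝ) : ℂ) • F₂ - T₂)) +
          (((1 + ε : ℝ) : ℂ) • F₁ - T₁) ∘ₗ T₂ := by
      simp only [LinearMap.sub_comp, LinearMap.comp_sub, LinearMap.smul_comp, LinearMap.comp_smul]
      push_cast
      module
    rw [CPLE_iff, e]
    exact ((hF₁.comp u₂).smul (by linarith)).add (u₁.comp hT₂)

/-- Distinct pairs may have the same product. Since the weight sums over all factorizations, the sum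
over products regroups into a sum over pairs. -/
theorem finiteTwirl_mulSet (A B : Finset (UGrp d)) (wA wB : UGrp d → ℝ) :
    finiteTwirl t (mulSet A B) (mulWeight A B wA wB) =
      finiteTwirl t A wA ∘ₗ finiteTwirl t B wB := by
  classical
  have h : ∀ U ∈ mulSet A B, ((mulWeight A B wA wB U : ℝ) : ℂ) • conjMap (tpow t U.1) =
      ∑ p ∈ A ×ˢ B with p.1 * p.2 = U,
        ((wA p.1 * wB p.2 : ℝ) : ℂ) • conjMap (tpow t (p.1 * p.2).1) := by
    intro U _
    rw [mulWeight, Complex.ofReal_sum, Finset.sum_smul]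
    refine Finset.sum_congr (by congr) fun p hp => ?_
    rw [(Finset.mem_filter.1 hp).2]
  rw [finiteTwirl, Finset.sum_congr rfl h, Finset.sum_fiberwise_of_maps_to, Finset.sum_product]
  · ext1 M
    simp only [finiteTwirl, LinearMap.comp_apply, LinearMap.sum_apply, map_sum,
      LinearMap.smul_apply, map_smul, Finset.smul_sum]
    rw [Finset.sum_comm]
    refine Finset.sum_congr rfl fun a _ => Finset.sum_congr rfl fun b _ => ?_
    have := conjU_mul (t := t) b a M
    simp only [conjU] at this
    rw [this, Complex.ofReal_mul, mul_comm, mul_smul]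
  · intro p hp
    rw [Finset.mem_product] at hp
    unfold mulSet
    convert Finset.mul_mem_mul hp.1 hp.2

theorem IsWeight.mulSet {A B : Finset (UGrp d)} {wA wB : UGrp d → ℝ} (hA : IsWeight A wA)
    (hB : IsWeight B wB) : IsWeight (mulSet A B) (mulWeight A B wA wB) := by
  classical
  refine ⟨fun U _ => Finset.sum_nonneg fun p hp => ?_, ?_⟩
  · have := Finset.mem_product.1 (Finset.mem_filter.1 hp).1
    exact mul_nonneg (hA.1 _ this.1) (hB.1 _ this.2)
  · have h : ∀ U ∈ OrthoDesign.mulSet A B, mulWeight A B wA wB U =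
        ∑ p ∈ A ×ˢ B with p.1 * p.2 = U, wA p.1 * wB p.2 := by
      intro U _
      rw [mulWeight]
    rw [Finset.sum_congr rfl h, Finset.sum_fiberwise_of_maps_to, Finset.sum_product,
      ← Finset.sum_mul_sum, hA.2, hB.2,
      one_mul]
    intro p hp
    rw [Finset.mem_product] at hp
    unfold OrthoDesign.mulSet
    convert Finset.mul_mem_mul hp.1 hp.2

theorem conjSet_injective (W : UGrp d) : Function.Injective fun U : UGrp d => W * U * W⁻¹ :=
  fun U V h => by simpa using h

theorem IsWeight.conjSet {V : Finset (UGrp d)} {w : UGrp d → ℝ} (hV : IsWeight V w) (W : UGrp d) :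
    IsWeight (conjSet W V) (conjWeight W w) := by
  classical
  constructor
  · intro U hU
    obtain ⟨A, hA, rfl⟩ := Finset.mem_image.1 hU
    simpa [conjWeight, mul_assoc] using hV.1 A hA
  · rw [OrthoDesign.conjSet, Finset.sum_image fun _ _ _ _ h => conjSet_injective W h, ← hV.2]
    simp [conjWeight, mul_assoc]

theorem finiteTwirl_conjSet (W : UGrp d) (V : Finset (UGrp d)) (w : UGrp d → ℝ) :
    finiteTwirl t (conjSet W V) (conjWeight W w) =
      conjU t W ∘ₗ finiteTwirl t V w ∘ₗ conjU t W⁻¹ := by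
  ext1 M
  rw [finiteTwirl, conjSet, Finset.sum_image fun _ _ _ _ h => conjSet_injective W h]
  simp only [finiteTwirl, LinearMap.comp_apply, LinearMap.sum_apply, map_sum,
    LinearMap.smul_apply, map_smul]
  refine Finset.sum_congr rfl fun U _ => ?_
  have : conjU t (W * U * W⁻¹) M = conjU t W (conjU t U (conjU t W⁻¹ M)) := by
    rw [conjU_mul, conjU_mul]
  simp only [conjU] at this ⊢
  rw [this]
  simp [conjWeight, mul_assoc]

theorem CPLE.conj {f g : TMat d t →ₗ[ℂ] TMat d t} (h : CPLE f g) (W : UGrp d) :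
    CPLE (conjU t W ∘ₗ f ∘ₗ conjU t W⁻¹) (conjU t W ∘ₗ g ∘ₗ conjU t W⁻¹) := by
  rw [CPLE_iff] at *
  have := (IsCP.conjMap (tpow t W.1)).comp (h.comp (IsCP.conjMap (tpow t W⁻¹.1)))
  rw [LinearMap.sub_comp, LinearMap.comp_sub] at this
  exact this

/-- If the product of the exact twirls is the unitary twirl, products of approximate orthogonal
designs with their rotations are approximate unitary designs. -/
theorem IsApproxOrthogonalDesign.mul_conj {W : UGrp d} {ε : ℝ} (hε : 0 < ε)
    (hW : rotatedTwirl t W ∘ₗ orthogonalTwirl d t = unitaryTwirl d t)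
    {V : Finset (UGrp d)} {w : UGrp d → ℝ} (hV : IsApproxOrthogonalDesign t ε V w) :
    IsApproxUnitaryDesign t (2 * ε + ε ^ 2) (mulSet (conjSet W V) V)
      (mulWeight (conjSet W V) V (conjWeight W w) w) := by
  have hF := IsCP.finiteTwirl (t := t) hV.weight.1
  have hF' := IsCP.finiteTwirl (t := t) (hV.weight.conjSet W).1
  have hT : IsCP (orthogonalTwirl d t) := IsCP.twirl _
  have hT' : IsCP (rotatedTwirl t W) := (IsCP.conjMap _).comp (hT.comp (IsCP.conjMap _))
  have hl := hV.lower.conj W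
  have hu := hV.upper.conj W
  rw [LinearMap.smul_comp, LinearMap.comp_smul, ← finiteTwirl_conjSet] at hl hu
  have h := CPLE_comp_bounds hε hT' hT hF' hF hl hu hV.lower hV.upper
  rw [hW, ← finiteTwirl_mulSet] at h
  exact ⟨(hV.weight.conjSet W).mulSet hV.weight, h.1, h.2⟩

end Products

/-! ### Invariant tensors of the orthogonal group -/

section InvariantTensors

variable {K : Type*} [Fintype K] [DecidableEq K] {d : ℕ}

/-- The tensors invariant under reflections, permutations and infinitesimal rotations of the
coordinates. -/
def invariantTensors (K : Type*) [Fintype K] [DecidableEq K] (d : ℕ) :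
    Submodule ℂ ((K → Fin d) → ℂ) where
  carrier := {T | (∀ (s : Fin d → ℂ), (∀ x, s x * s x = 1) → ∀ i, (∏ k, s (i k)) * T i = T i) ∧
    (∀ (σ : Equiv.Perm (Fin d)) i, T (fun k => σ (i k)) = T i) ∧
    (∀ (a c : Fin d), a ≠ c → ∀ i, (∑ k, if i k = a then T (Function.update i k c) else 0) =
      ∑ k, if i k = c then T (Function.update i k a) else 0)}
  add_mem' := by
    rintro S T ⟨hS, hS', hS''⟩ ⟨hT, hT', hT''⟩
    refine ⟨fun s hs i => ?_, fun σ i => ?_, fun a c hac i => ?_⟩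
    · rw [Pi.add_apply, mul_add, hS s hs, hT s hs]
    · rw [Pi.add_apply, Pi.add_apply, hS', hT']
    · have := congrArg₂ (· + ·) (hS'' a c hac i) (hT'' a c hac i)
      simpa only [Pi.add_apply, ite_add_zero, Finset.sum_add_distrib] using this
  zero_mem' := by simp
  smul_mem' := by
    rintro r T ⟨hT, hT', hT''⟩
    refine ⟨fun s hs i => ?_, fun σ i => ?_, fun a c hac i => ?_⟩
    · rw [Pi.smul_apply, smul_eq_mul, mul_left_comm, hT s hs]
    · rw [Pi.smul_apply, Pi.smul_apply, hT']
    · have := congrArg (r * ·) (hT'' a c hac i)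
      simpa only [Pi.smul_apply, smul_eq_mul, Finset.mul_sum, mul_ite, mul_zero] using this

/-- The action of a real matrix on tensors. -/
def tensorAct (A : Matrix (Fin d) (Fin d) ℝ) (T : (K → Fin d) → ℂ) (i : K → Fin d) : ℂ :=
  ∑ j, (∏ k, (A (i k) (j k) : ℂ)) * T j

theorem tensorAct_diagonal (s : Fin d → ℝ) (T : (K → Fin d) → ℂ) (i : K → Fin d) :
    tensorAct (Matrix.diagonal s) T i = (∏ k, (s (i k) : ℂ)) * T i := by
  rw [tensorAct, Finset.sum_eq_single i]
  · simp
  · intro j _ hj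
    obtain ⟨k, hk⟩ := Function.ne_iff.1 hj
    rw [Finset.prod_eq_zero (Finset.mem_univ k), zero_mul]
    simp [Matrix.diagonal_apply_ne _ (Ne.symm hk)]
  · simp

theorem tensorAct_perm (σ : Equiv.Perm (Fin d)) (T : (K → Fin d) → ℂ) (i : K → Fin d) :
    tensorAct (Matrix.of fun x y => if y = σ x then (1 : ℝ) else 0) T i = T fun k => σ (i k) := by
  rw [tensorAct, Finset.sum_eq_single fun k => σ (i k)]
  · simp
  · intro j _ hj
    obtain ⟨k, hk⟩ := Function.ne_iff.1 hj
    rw [Finset.prod_eq_zero (Finset.mem_univ k), zero_mul]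
    simp [hk]
  · simp

/-- The rotation by the angle `θ` in the plane of the coordinates `a`, `c`. -/
def planeRotation (a c : Fin d) (θ : ℝ) : Matrix (Fin d) (Fin d) ℝ :=
  1 + (Real.cos θ - 1) • (Matrix.single a a 1 + Matrix.single c c 1) +
    Real.sin θ • (Matrix.single a c 1 - Matrix.single c a 1)

theorem planeRotation_mul_transpose {a c : Fin d} (hac : a ≠ c) (θ : ℝ) :
    planeRotation a c θ * (planeRotation a c θ)ᵀ = 1 := by
  have h1 : (planeRotation a c θ)ᵀ =
      1 + (Real.cos θ - 1) • (Matrix.single a a 1 + Matrix.single c c 1) -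
        Real.sin θ • (Matrix.single a c 1 - Matrix.single c a 1) := by
    simp only [planeRotation, Matrix.transpose_add, Matrix.transpose_smul, Matrix.transpose_one,
      Matrix.transpose_single, Matrix.transpose_sub]
    module
  rw [h1, planeRotation]
  have h2 := Real.sin_sq_add_cos_sq θ
  simp only [mul_add, add_mul, mul_sub, sub_mul, smul_mul_assoc, mul_smul_comm, one_mul, mul_one,
    Matrix.single_mul_single_same, Matrix.single_mul_single_of_ne _ _ _ _ hac,
    Matrix.single_mul_single_of_ne _ _ _ _ hac.symm, smul_add, smul_sub]
  have h3 : Real.sin θ * Real.sin θ = 1 - Real.cos θ * Real.cos θ := by linarith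
  simp only [smul_smul, h3]
  module

theorem hasDerivAt_planeRotation (a c x y : Fin d) :
    HasDerivAt (fun θ : ℝ => ((planeRotation a c θ x y : ℝ) : ℂ))
      ((if x = a ∧ y = c then 1 else 0) - (if x = c ∧ y = a then 1 else 0)) 0 := by
  have h1 : HasDerivAt (fun θ : ℝ => planeRotation a c θ x y)
      (((0 : ℝ) + (-Real.sin 0) * (Matrix.single a a 1 + Matrix.single c c 1 : Matrix (Fin d) (Fin d) ℝ) x y) +
        Real.cos 0 * (Matrix.single a c 1 - Matrix.single c a 1 : Matrix (Fin d) (Fin d) ℝ) x y) 0 :=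
    ((hasDerivAt_const (0 : ℝ) ((1 : Matrix (Fin d) (Fin d) ℝ) x y)).add
      (((Real.hasDerivAt_cos 0).sub_const 1).mul_const _)).add
        ((Real.hasDerivAt_sin 0).mul_const _)
  convert h1.ofReal_comp using 1
  simp only [Matrix.sub_apply, Matrix.single_apply, Real.sin_zero, Real.cos_zero]
  simp only [eq_comm (a := a), eq_comm (a := c)]
  simp only [neg_zero, zero_mul, add_zero, zero_add, one_mul]
  split_ifs <;> simp

theorem planeRotation_zero (a c : Fin d) : planeRotation a c 0 = 1 := by
  simp [planeRotation]

/-- The infinitesimal form of the invariance under plane rotations. -/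
theorem lie_relation {T : (K → Fin d) → ℂ} {a c : Fin d}
    (hT : ∀ θ i, tensorAct (planeRotation a c θ) T i = T i) (i : K → Fin d) :
    (∑ k, if i k = a then T (Function.update i k c) else 0) =
      ∑ k, if i k = c then T (Function.update i k a) else 0 := by
  have h1 : HasDerivAt (fun θ : ℝ => tensorAct (planeRotation a c θ) T i)
      (∑ j, (∑ k, (∏ l ∈ Finset.univ.erase k, ((planeRotation a c 0 (i l) (j l) : ℝ) : ℂ)) •
        ((if i k = a ∧ j k = c then (1 : ℂ) else 0) - (if i k = c ∧ j k = a then 1 else 0))) * T j)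
        0 :=
    HasDerivAt.fun_sum fun j _ => (HasDerivAt.fun_finsetProd fun k _ =>
      hasDerivAt_planeRotation a c (i k) (j k)).mul_const (T j)
  -- By invariance the differentiated function is constant, so the derivative given by the product
  -- rule is zero.
  simp only [hT] at h1
  have h2 := h1.unique (hasDerivAt_const _ _)
  -- At angle zero the rotation is the identity, so the factors away from `k` force `j` to agree
  -- with `i` there.
  have h3 : ∀ (k : K) (u v : Fin d), (∑ j : K → Fin d,
      (∏ l ∈ Finset.univ.erase k, ((planeRotation a c 0 (i l) (j l) : ℝ) : ℂ)) *
        (if i k = u ∧ j k = v then (1 : ℂ) else 0) * T j) =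
          if i k = u then T (Function.update i k v) else 0 := by
    intro k u v
    rw [Finset.sum_eq_single (Function.update i k v)]
    · have : ∀ l ∈ Finset.univ.erase k,
          ((planeRotation a c 0 (i l) (Function.update i k v l) : ℝ) : ℂ) = 1 := by
        intro l hl
        simp [planeRotation_zero, Function.update_of_ne (Finset.ne_of_mem_erase hl)]
      rw [Finset.prod_congr rfl this]
      simp
    · intro j _ hj
      by_cases hv : j k = v
      · obtain ⟨l, hl⟩ := Function.ne_iff.1 hj
        have hlk : l ≠ k := by
          rintro rfl
          simp [hv] at hl
        rw [Function.update_of_ne hlk] at hl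
        rw [Finset.prod_eq_zero (Finset.mem_erase.2 ⟨hlk, Finset.mem_univ l⟩), zero_mul, zero_mul]
        simp [planeRotation_zero, Matrix.one_apply_ne (Ne.symm hl)]
      · simp [hv]
    · simp
  simp only [smul_eq_mul, Finset.sum_mul, mul_sub, sub_mul, Finset.sum_sub_distrib] at h2
  rw [Finset.sum_comm, Finset.sum_congr rfl fun k _ => h3 k a c, Finset.sum_comm,
    Finset.sum_congr rfl fun k _ => h3 k c a] at h2
  exact sub_eq_zero.1 h2

/-- Invariance under `O(d)` gives the coordinate relations. -/
theorem mem_invariantTensors {T : (K → Fin d) → ℂ}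
    (hT : ∀ A : Matrix (Fin d) (Fin d) ℝ, A * Aᵀ = 1 → ∀ i, tensorAct A T i = T i) :
    T ∈ invariantTensors K d := by
  refine ⟨fun s hs i => ?_, fun σ i => ?_, fun a c hac i => ?_⟩
  -- The values of `s` are `±1`, so `s` comes from a real diagonal reflection.
  · have h1 : ∀ x, (((s x).re : ℝ) : ℂ) = s x := by
      intro x
      rcases mul_self_eq_one_iff.1 (hs x) with h | h <;> simp [h]
    have h2 : ∀ x, (s x).re * (s x).re = 1 := by
      intro x
      rcases mul_self_eq_one_iff.1 (hs x) with h | h <;> simp [h]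
    have h3 := hT (Matrix.diagonal fun x => (s x).re) (by
      rw [Matrix.diagonal_transpose, Matrix.diagonal_mul_diagonal]
      simp only [h2]
      exact Matrix.diagonal_one) i
    rw [tensorAct_diagonal] at h3
    simpa only [h1] using h3
  · rw [← tensorAct_perm σ T i]
    refine hT _ ?_ i
    ext x y
    simp only [Matrix.mul_apply, Matrix.of_apply, Matrix.transpose_apply, Matrix.one_apply, mul_ite,
      mul_one, mul_zero, Finset.sum_ite_eq', Finset.mem_univ, if_true, σ.injective.eq_iff]
    exact if_congr eq_comm rfl rfl
  · exact lie_relation (fun θ j => hT _ (planeRotation_mul_transpose hac θ) j) i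

/-- A tensor invariant under reflections vanishes at indices with an odd fiber. -/
theorem eq_zero_of_odd {T : (K → Fin d) → ℂ} (hT : T ∈ invariantTensors K d) (i : K → Fin d)
    (a : Fin d) (h : Odd (Finset.univ.filter fun k => i k = a).card) : T i = 0 := by
  have h1 := hT.1 (fun x => if x = a then -1 else 1) (fun x => by split_ifs <;> simp) i
  rw [Finset.prod_ite, Finset.prod_const, Finset.prod_const_one, h.neg_one_pow] at h1
  linear_combination (-1 / 2 : ℂ) * h1

/-! ### Pairing tensors -/

/-- The pairings of `K`, as involutions without fixed points. -/
def pairings (K : Type*) [Fintype K] [DecidableEq K] : Finset (K → K) :=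
  Finset.univ.filter fun p => ∀ k, p (p k) = k ∧ p k ≠ k

theorem mem_pairings {p : K → K} : p ∈ pairings K ↔ ∀ k, p (p k) = k ∧ p k ≠ k := by
  simp [pairings]

/-- The product of the metric tensors over the pairs of `p`. -/
def pairTensor (d : ℕ) (p : K → K) (i : K → Fin d) : ℂ := if ∀ k, i (p k) = i k then 1 else 0

/-- Signs cancel within each pair. In the infinitesimal relation, the term at `k` on one side equals
the term at its partner `p k` on the other. -/
theorem pairTensor_mem {p : K → K} (hp : p ∈ pairings K) :
    pairTensor d p ∈ invariantTensors K d := by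
  rw [mem_pairings] at hp
  refine ⟨fun s hs i => ?_, fun σ i => ?_, fun a c hac i => ?_⟩
  · unfold pairTensor
    split_ifs with h
    · rw [mul_one]
      refine Finset.prod_involution (fun k _ => p k) (fun k _ => ?_) (fun k _ _ => (hp k).2)
        (fun _ _ => Finset.mem_univ _) (fun k _ => (hp k).1)
      rw [h, hs]
    · simp
  · simp [pairTensor]
  · let e : K ≃ K := ⟨p, p, fun k => (hp k).1, fun k => (hp k).1⟩
    -- If recoloring `k` from `u` to `v` makes the index constant on pairs, the only defect was the
    -- pair of `k`. Its partner then has color `v`, and recoloring the partner to `u` repairs the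
    -- index as well.
    have key : ∀ k (u v : Fin d), u ≠ v → i k = u →
        (∀ l, Function.update i k v (p l) = Function.update i k v l) →
        i (p k) = v ∧ ∀ l, Function.update i (p k) u (p l) = Function.update i (p k) u l := by
      intro k u v huv hk h
      have h1 : i (p k) = v := by
        have := h k
        rwa [Function.update_self, Function.update_of_ne (hp k).2] at this
      refine ⟨h1, fun l => ?_⟩
      rcases eq_or_ne l k with rfl | hlk
      · rw [Function.update_self, Function.update_of_ne (hp l).2.symm, hk]
      rcases eq_or_ne l (p k) with rfl | hlp
      · rw [(hp k).1, Function.update_self, Function.update_of_ne (hp k).2.symm, hk]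
      have h2 : p l ≠ k := fun h => hlp (by rw [← h, (hp l).1])
      have h3 : p l ≠ p k := fun h => hlk (by rw [← (hp l).1, h, (hp k).1])
      have := h l
      rw [Function.update_of_ne hlk, Function.update_of_ne h2] at this
      rw [Function.update_of_ne hlp, Function.update_of_ne h3, this]
    rw [← e.sum_comp (fun k => if i k = c then pairTensor d p (Function.update i k a) else 0)]
    refine Finset.sum_congr rfl fun k _ => ?_
    change _ = if i (p k) = c then pairTensor d p (Function.update i (p k) a) else 0
    unfold pairTensor
    simp only [← ite_and]
    refine if_congr ⟨fun h => ?_, fun h => ?_⟩ rfl rfl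
    · exact key k a c hac h.1 h.2
    · have := key (p k) c a hac.symm h.1 h.2
      rwa [(hp k).1] at this

/-- If there are enough colors, an invariant tensor is determined by its values at the indices
all of whose fibers are empty or pairs. -/
theorem eq_zero_of_forall_pairs (hd : Fintype.card K ≤ 2 * d) {T : (K → Fin d) → ℂ}
    (hT : T ∈ invariantTensors K d)
    (h : ∀ i : K → Fin d, (∀ a, (Finset.univ.filter fun k => i k = a).card = 0 ∨
      (Finset.univ.filter fun k => i k = a).card = 2) → T i = 0) : T = 0 := by
  suffices H : ∀ (n : ℕ) (i : K → Fin d),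
      (Finset.univ.filter fun a => ∀ k, i k ≠ a).card = n → T i = 0 from
    funext fun i => H _ i rfl
  -- Induction on the number of unused colors.
  intro n
  induction n using Nat.strong_induction_on with
  | _ n ih =>
  intro i hn
  by_cases ho : ∃ a, Odd (Finset.univ.filter fun k => i k = a).card
  · obtain ⟨a, ha⟩ := ho
    exact eq_zero_of_odd hT i a ha
  push Not at ho
  by_cases hp : ∀ a, (Finset.univ.filter fun k => i k = a).card = 0 ∨
      (Finset.univ.filter fun k => i k = a).card = 2
  · exact h i hp
  push Not at hp
  obtain ⟨a, ha0, ha2⟩ := hp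
  have ha4 : 4 ≤ (Finset.univ.filter fun k => i k = a).card := by
    have := Nat.not_odd_iff_even.1 (ho a)
    obtain ⟨r, hr⟩ := this
    omega
  -- Were every color used, all fibers would have at least two points and the one over `a` at least
  -- four, exceeding `2 * d` in total.
  obtain ⟨c, hc⟩ : ∃ c, ∀ k, i k ≠ c := by
    by_contra! hcon
    have h1 : ∀ b, 2 ≤ (Finset.univ.filter fun k => i k = b).card := by
      intro b
      obtain ⟨k, hk⟩ := hcon b
      have h2 : 0 < (Finset.univ.filter fun k => i k = b).card :=
        Finset.card_pos.2 ⟨k, by simp [hk]⟩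
      obtain ⟨r, hr⟩ := Nat.not_odd_iff_even.1 (ho b)
      omega
    have h2 : Fintype.card K = ∑ b, (Finset.univ.filter fun k => i k = b).card := by
      rw [← Finset.card_univ]
      exact Finset.card_eq_sum_card_fiberwise fun _ _ => Finset.mem_univ _
    have h3 : ∑ _b : Fin d, 2 < ∑ b, (Finset.univ.filter fun k => i k = b).card :=
      Finset.sum_lt_sum (fun b _ => h1 b) ⟨a, Finset.mem_univ _, by omega⟩
    simp at h3
    omega
  obtain ⟨q, hq⟩ : (Finset.univ.filter fun k => i k = a).Nonempty := Finset.card_pos.1 (by omega)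
  have hqa : i q = a := (Finset.mem_filter.1 hq).2
  have hac : a ≠ c := hqa ▸ hc q
  -- With one `a` recolored to the unused `c`, the right side of the relation is the single term `T
  -- i`. Each nonzero term on the left recolors a second `a`; since the fiber had at least four
  -- points, `a` stays in use and one color fewer is unused.
  have hlie := hT.2.2 a c hac (Function.update i q c)
  have hr : (∑ k, if Function.update i q c k = c
      then T (Function.update (Function.update i q c) k a) else 0) = T i := by
    rw [Finset.sum_eq_single q]
    · simp [← hqa]
    · intro k _ hk
      rw [Function.update_of_ne hk, if_neg (hc k)]
    · simp
  rw [← hr, ← hlie]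
  refine Finset.sum_eq_zero fun k _ => ?_
  split_ifs with hk
  swap
  · rfl
  refine ih _ ?_ _ rfl
  rw [← hn]
  refine Finset.card_lt_card (Finset.ssubset_iff_subset_ne.2 ⟨?_, ?_⟩)
  · intro x hx
    simp only [Finset.mem_filter, Finset.mem_univ, true_and] at hx ⊢
    intro l hl
    rcases eq_or_ne x a with rfl | hxa
    · obtain ⟨l', hl'⟩ : (((Finset.univ.filter fun k => i k = x).erase q).erase k).Nonempty := by
        rw [← Finset.card_pos]
        have h1 := Finset.pred_card_le_card_erase (s := Finset.univ.filter fun k => i k = x) (a := q)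
        have h2 := Finset.pred_card_le_card_erase
          (s := (Finset.univ.filter fun k => i k = x).erase q) (a := k)
        omega
      simp only [Finset.mem_erase, Finset.mem_filter, Finset.mem_univ, true_and] at hl'
      apply hx l'
      rw [Function.update_of_ne hl'.1, Function.update_of_ne hl'.2.1, hl'.2.2]
    · have h1 : l ≠ q := by
        rintro rfl
        exact hxa (hl.symm.trans hqa)
      have h2 : l ≠ k := by
        rintro rfl
        rw [Function.update_of_ne h1] at hk
        exact hxa (hl.symm.trans hk)
      apply hx l
      rw [Function.update_of_ne h2, Function.update_of_ne h1, hl]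
  · intro h1
    have h2 : c ∈ Finset.univ.filter fun a => ∀ k, i k ≠ a := by simpa using hc
    rw [← h1] at h2
    simp only [Finset.mem_filter, Finset.mem_univ, true_and] at h2
    exact h2 k (Function.update_self _ _ _)

/-- Two maps with the same kernel differ by a permutation of the codomain. -/
theorem exists_perm_comp_eq {β α : Type*} [Fintype α] [DecidableEq α] {i j : β → α}
    (h : ∀ k l, i k = i l ↔ j k = j l) : ∃ σ : Equiv.Perm α, ∀ k, σ (i k) = j k := by
  classical
  have hc : ∀ k, j (Classical.choose (Set.mem_range_self (f := i) k)) = j k := fun k =>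
    (h _ _).1 (Classical.choose_spec (Set.mem_range_self (f := i) k))
  have hc' : ∀ k, i (Classical.choose (Set.mem_range_self (f := j) k)) = i k := fun k =>
    (h _ _).2 (Classical.choose_spec (Set.mem_range_self (f := j) k))
  let e : {x // x ∈ Set.range i} ≃ {x // x ∈ Set.range j} :=
    { toFun := fun x => ⟨j (Classical.choose x.2), Set.mem_range_self _⟩
      invFun := fun x => ⟨i (Classical.choose x.2), Set.mem_range_self _⟩
      left_inv := by
        rintro ⟨_, k, rfl⟩
        refine Subtype.ext ?_
        exact (hc' _).trans (Classical.choose_spec (Set.mem_range_self (f := i) k))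
      right_inv := by
        rintro ⟨_, k, rfl⟩
        refine Subtype.ext ?_
        exact (hc _).trans (Classical.choose_spec (Set.mem_range_self (f := j) k)) }
  refine ⟨e.extendSubtype, fun k => ?_⟩
  rw [Equiv.extendSubtype_apply_of_mem _ _ (Set.mem_range_self k)]
  exact hc k

/-- The first fundamental theorem for `O(d)`, when there are at least as many colors as pairs. -/
theorem invariantTensors_le_span (hd : Fintype.card K ≤ 2 * d) :
    invariantTensors K d ≤ Submodule.span ℂ (pairTensor d '' (pairings K : Set (K → K))) := by
  classical
  intro T hT
  -- A good index has the pairs of `p` as its fibers. Any two differ by a permutation of colors, so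
  -- the value of `T` does not depend on the choice; the default `0` is never used.
  let good (p : K → K) (i : K → Fin d) : Prop := ∀ k l, i k = i l ↔ l = k ∨ l = p k
  let coef (p : K → K) : ℂ := if h : ∃ i, good p i then T h.choose else 0
  have hS : ∑ p ∈ pairings K, coef p • pairTensor d p ∈
      Submodule.span ℂ (pairTensor d '' (pairings K : Set (K → K))) :=
    Submodule.sum_mem _ fun p hp => Submodule.smul_mem _ _
      (Submodule.subset_span ⟨p, hp, rfl⟩)
  suffices H : T - ∑ p ∈ pairings K, coef p • pairTensor d p = 0 by
    rwa [sub_eq_zero.1 H]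
  refine eq_zero_of_forall_pairs hd (Submodule.sub_mem _ hT (Submodule.sum_mem _ fun p hp =>
    Submodule.smul_mem _ _ (pairTensor_mem hp))) fun i hi => ?_
  have h2 : ∀ k, ∃ q, q ≠ k ∧ ∀ l, i k = i l ↔ l = k ∨ l = q := by
    intro k
    have h3 : (Finset.univ.filter fun l => i l = i k).card = 2 := by
      refine (hi (i k)).resolve_left fun h => ?_
      rw [Finset.card_eq_zero] at h
      have : k ∈ Finset.univ.filter fun l => i l = i k := by simp
      rw [h] at this
      simp at this
    have h4 : ((Finset.univ.filter fun l => i l = i k).erase k).card = 1 := by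
      rw [Finset.card_erase_of_mem (by simp), h3]
    obtain ⟨q, hq⟩ := Finset.card_eq_one.1 h4
    have hq' : ∀ l, (l ≠ k ∧ i l = i k) ↔ l = q := by
      intro l
      have := Finset.ext_iff.1 hq l
      simpa using this
    refine ⟨q, ((hq' q).2 rfl).1, fun l => ?_⟩
    rw [← hq', eq_comm]
    by_cases hl : l = k <;> simp [hl]
  choose p hp hpi using h2
  have hinv : ∀ k, p (p k) = k := by
    intro k
    have h3 : i (p k) = i k := ((hpi k (p k)).2 (Or.inr rfl)).symm
    exact (((hpi (p k) k).1 h3).resolve_left (hp k).symm).symm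
  have hpm : p ∈ pairings K := mem_pairings.2 fun k => ⟨hinv k, hp k⟩
  rw [Pi.sub_apply, Finset.sum_apply, Finset.sum_eq_single p]
  · have hex : ∃ i, good p i := ⟨i, hpi⟩
    have h3 : coef p = T i := by
      simp only [coef, dif_pos hex]
      obtain ⟨σ, hσ⟩ := exists_perm_comp_eq (i := i) (j := hex.choose) fun k l =>
        (hpi k l).trans (hex.choose_spec k l).symm
      rw [← hT.2.1 σ i]
      congr 1
      funext k
      exact (hσ k).symm
    have h4 : pairTensor d p i = 1 := if_pos fun k => ((hpi k (p k)).2 (Or.inr rfl)).symm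
    rw [Pi.smul_apply, h3, h4, smul_eq_mul, mul_one, sub_self]
  -- A pairing whose tensor is nonzero at `i` joins equal colors, and the fibers of `i` leave only
  -- `p`.
  · intro q hq hqp
    have : pairTensor d q i = 0 := by
      refine if_neg fun h => hqp (funext fun k => ?_)
      exact ((hpi k (q k)).1 (h k).symm).resolve_left (mem_pairings.1 hq k).2
    rw [Pi.smul_apply, this, smul_zero]
  · exact fun h => absurd hpm h

end InvariantTensors

/-! ### Invariant tensors of degree six in two colors -/

section TwoColors

theorem fin_two_eq_zero_or_one (x : Fin 2) : x = 0 ∨ x = 1 := by omega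

/-- The index with color `1` exactly at `k` and `l`. -/
def pairIndex {K : Type*} [DecidableEq K] (k l : K) : K → Fin 2 := fun x => if x = k ∨ x = l then 1 else 0

theorem pairIndex_comm {K : Type*} [DecidableEq K] (k l : K) : pairIndex k l = pairIndex l k := by
  funext x
  simp only [pairIndex, or_comm]

variable {K : Type*} [Fintype K] [DecidableEq K]

/-- The infinitesimal relation at the index with a single `1`, placed at `k`. Reading values at pair
indices as edge weights, it says that all vertex degrees agree. -/
theorem sum_pairIndex {T : (K → Fin 2) → ℂ} (hT : T ∈ invariantTensors K 2) (k : K) :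
    (∑ l, if l = k then 0 else T (pairIndex k l)) = T fun _ => 0 := by
  have h := hT.2.2 0 1 zero_ne_one (Function.update (fun _ => 0) k 1)
  have hr : (∑ l, if Function.update (fun _ => (0 : Fin 2)) k 1 l = 1
      then T (Function.update (Function.update (fun _ => 0) k 1) l 0) else 0) = T fun _ => 0 := by
    rw [Finset.sum_eq_single k]
    · simp
    · intro l _ hl
      simp [Function.update_of_ne hl]
    · simp
  rw [← hr, ← h]
  refine Finset.sum_congr rfl fun l _ => ?_
  rcases eq_or_ne l k with rfl | hl
  · simp
  · rw [if_neg hl, Function.update_of_ne hl, if_pos rfl]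
    congr 1
    funext x
    by_cases h1 : x = l
    · simp [pairIndex, h1]
    · by_cases h2 : x = k
      · simp [pairIndex, h2, Function.update_of_ne hl.symm]
      · simp [pairIndex, h1, h2]

theorem eq_pairIndex_of_card {i : K → Fin 2}
    (h : (Finset.univ.filter fun k => i k = 1).card = 2) :
    ∃ k l, k ≠ l ∧ i = pairIndex k l := by
  obtain ⟨k, l, hkl, h⟩ := Finset.card_eq_two.1 h
  refine ⟨k, l, hkl, funext fun x => ?_⟩
  have := Finset.ext_iff.1 h x
  simp only [Finset.mem_filter, Finset.mem_univ, true_and, Finset.mem_insert,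
    Finset.mem_singleton] at this
  unfold pairIndex
  split_ifs with hx
  · exact this.2 hx
  · exact (fin_two_eq_zero_or_one (i x)).resolve_right fun h => hx (this.1 h)

/-- An odd number of ones gives zero by reflection, no ones reduces to pairs by the degree relation,
and four or six ones reduce to two or none by exchanging the colors. -/
theorem eq_zero_of_forall_pairIndex (hK : Fintype.card K = 6) {T : (K → Fin 2) → ℂ}
    (hT : T ∈ invariantTensors K 2) (h : ∀ k l, k ≠ l → T (pairIndex k l) = 0) : T = 0 := by
  have h0 : T (fun _ => 0) = 0 := by
    obtain ⟨k⟩ : Nonempty K := Fintype.card_pos_iff.1 (by omega)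
    rw [← sum_pairIndex hT k]
    refine Finset.sum_eq_zero fun l _ => ?_
    split_ifs with hl
    · rfl
    · exact h k l (Ne.symm hl)
  have hlow : ∀ i : K → Fin 2, (Finset.univ.filter fun k => i k = 1).card < 3 → T i = 0 := by
    intro i hi
    by_cases ho : Odd (Finset.univ.filter fun k => i k = 1).card
    · exact eq_zero_of_odd hT i 1 ho
    obtain ⟨r, hr⟩ := Nat.not_odd_iff_even.1 ho
    rcases (by omega : r = 0 ∨ r = 1) with rfl | rfl
    · have : i = fun _ => 0 := by
        funext x
        refine (fin_two_eq_zero_or_one (i x)).resolve_right fun hx => ?_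
        have h1 := Finset.card_eq_zero.1 hr
        have h2 : x ∈ Finset.univ.filter fun k => i k = 1 := by simpa using hx
        rw [h1] at h2
        simp at h2
      rw [this, h0]
    · obtain ⟨k, l, hkl, rfl⟩ := eq_pairIndex_of_card hr
      exact h k l hkl
  funext i
  have hcard := Finset.card_filter_add_card_filter_not (s := Finset.univ) fun k => i k = 1
  rw [Finset.card_univ, hK] at hcard
  by_cases hi : (Finset.univ.filter fun k => i k = 1).card < 3
  · exact hlow i hi
  by_cases ho : Odd (Finset.univ.filter fun k => i k = 1).card
  · exact eq_zero_of_odd hT i 1 ho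
  obtain ⟨r, hr⟩ := Nat.not_odd_iff_even.1 ho
  rw [← hT.2.1 (Equiv.swap 0 1)]
  refine hlow _ ?_
  have : (Finset.univ.filter fun k => Equiv.swap (0 : Fin 2) 1 (i k) = 1) =
      Finset.univ.filter fun k => ¬ i k = 1 := by
    refine Finset.filter_congr fun k _ => ?_
    rcases fin_two_eq_zero_or_one (i k) with h | h <;> simp [h]
  rw [this]
  omega

/-- The fifteen pairings of six points. -/
def sixPairing : Fin 15 → Fin 6 → Fin 6 :=
  ![![1, 0, 3, 2, 5, 4], ![1, 0, 4, 5, 2, 3], ![1, 0, 5, 4, 3, 2],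
    ![2, 3, 0, 1, 5, 4], ![2, 4, 0, 5, 1, 3], ![2, 5, 0, 4, 3, 1],
    ![3, 2, 1, 0, 5, 4], ![3, 4, 5, 0, 1, 2], ![3, 5, 4, 0, 2, 1],
    ![4, 2, 1, 5, 0, 3], ![4, 3, 5, 1, 0, 2], ![4, 5, 3, 2, 0, 1],
    ![5, 2, 1, 4, 3, 0], ![5, 3, 4, 1, 2, 0], ![5, 4, 3, 2, 1, 0]]

theorem sixPairing_spec : ∀ r k, sixPairing r (sixPairing r k) = k ∧ sixPairing r k ≠ k := by
  decide

set_option maxHeartbeats 2000000 in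
/-- A symmetric edge weighting of `K₆` with constant vertex degrees is a combination of perfect
matchings. -/
theorem sum_sixPairing (g : Fin 6 → Fin 6 → ℂ) (c : ℂ) (hg : ∀ k l, g k l = g l k)
    (hc : ∀ k, (∑ l, if l = k then 0 else g k l) = c) (k l : Fin 6) (hkl : k ≠ l) :
    (∑ r, ((∑ x, g x (sixPairing r x)) / 8 - c / 12) * if sixPairing r k = l then 1 else 0) =
      g k l := by
  -- The coefficient is `g(m) / 4 - c / 12` with `g(m)` the weight of the matching, each edge being
  -- counted twice in the sum over `x`. Three matchings contain the edge `kl`, and each edge on the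
  -- other four vertices lies in exactly one of them. Those edges have total weight `3c - (2c - g k
  -- l) = c + g k l`, so the sum is `(3 g k l + c + g k l) / 4 - c / 4 = g k l`.
  have h0 := hc 0
  have h1 := hc 1
  have h2 := hc 2
  have h3 := hc 3
  have h4 := hc 4
  have h5 := hc 5
  simp only [Fin.sum_univ_six, Fin.isValue, Fin.reduceEq, if_true, if_false, zero_add, hg 1 0, hg 2 0,
    hg 3 0, hg 4 0, hg 5 0, hg 2 1, hg 3 1, hg 4 1, hg 5 1, hg 3 2, hg 4 2, hg 5 2, hg 4 3, hg 5 3,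
    hg 5 4] at h0 h1 h2 h3 h4 h5
  fin_cases k <;> fin_cases l <;> first
    | exact absurd rfl hkl
    | (clear hkl hc
       simp [Fin.sum_univ_succ, sixPairing, hg 1 0, hg 2 0, hg 3 0, hg 4 0, hg 5 0, hg 2 1, hg 3 1,
         hg 4 1, hg 5 1, hg 3 2, hg 4 2, hg 5 2, hg 4 3, hg 5 3, hg 5 4]
       clear hg
       grind)

/-- The first fundamental theorem for `O(2)` in degree six. -/
theorem invariantTensors_two_le_span (hK : Fintype.card K = 6) :
    invariantTensors K 2 ≤ Submodule.span ℂ (pairTensor 2 '' (pairings K : Set (K → K))) := by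
  intro T hT
  let e : K ≃ Fin 6 := Fintype.equivFinOfCardEq hK
  let p (r : Fin 15) (k : K) : K := e.symm (sixPairing r (e k))
  have hp : ∀ r, p r ∈ pairings K := fun r => mem_pairings.2 fun k => by
    refine ⟨by simp [p, (sixPairing_spec r _).1], fun h => (sixPairing_spec r (e k)).2 ?_⟩
    have := congrArg e h
    simpa [p] using this
  let g (x y : Fin 6) : ℂ := T (pairIndex (e.symm x) (e.symm y))
  let coef (r : Fin 15) : ℂ := (∑ x, g x (sixPairing r x)) / 8 - T (fun _ => 0) / 12
  have hS : ∑ r, coef r • pairTensor 2 (p r) ∈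
      Submodule.span ℂ (pairTensor 2 '' (pairings K : Set (K → K))) :=
    Submodule.sum_mem _ fun r _ => Submodule.smul_mem _ _
      (Submodule.subset_span ⟨p r, hp r, rfl⟩)
  suffices H : T - ∑ r, coef r • pairTensor 2 (p r) = 0 by
    rwa [sub_eq_zero.1 H]
  refine eq_zero_of_forall_pairIndex hK (Submodule.sub_mem _ hT (Submodule.sum_mem _ fun r _ =>
    Submodule.smul_mem _ _ (pairTensor_mem (hp r)))) fun k l hkl => ?_
  have h1 := sum_sixPairing g (T fun _ => 0) (fun x y => by simp only [g, pairIndex_comm])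
    (fun x => by
      rw [← sum_pairIndex hT (e.symm x), ← e.symm.sum_comp]
      simp [g]) (e k) (e l) (by simpa using hkl)
  -- A pairing is compatible with the coloring that singles out `k` and `l` exactly when it joins
  -- them.
  have h2 : ∀ r, pairTensor 2 (p r) (pairIndex k l) = if sixPairing r (e k) = e l then 1 else 0 := by
    intro r
    have hr := mem_pairings.1 (hp r)
    refine if_congr ?_ rfl rfl
    have h3 : sixPairing r (e k) = e l ↔ p r k = l := by simp [p, Equiv.symm_apply_eq]
    rw [h3]
    constructor
    · intro h
      have := h k
      simp only [pairIndex, true_or, if_true] at this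
      by_contra hne
      rw [if_neg (by simp [hne, (hr k).2])] at this
      exact absurd this (by decide)
    · rintro rfl x
      refine if_congr ⟨fun h => ?_, fun h => ?_⟩ rfl rfl
      · rcases h with h | h
        · exact Or.inr (by rw [← h, (hr x).1])
        · exact Or.inl (by rw [← (hr x).1, h, (hr k).1])
      · rcases h with h | h
        · exact Or.inr (by rw [h])
        · exact Or.inl (by rw [h, (hr k).1])
  rw [Pi.sub_apply, Finset.sum_apply]
  simp only [Pi.smul_apply, smul_eq_mul, h2]
  rw [h1]
  simp [g]

end TwoColors

/-! ### The commutant of the orthogonal group -/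

section Commutant

variable {d t : ℕ}

/-- The operator of the Brauer diagram `p`. -/
def pairMat (d t : ℕ) (p : Fin t ⊕ Fin t → Fin t ⊕ Fin t) : TMat d t :=
  Matrix.of fun i j => pairTensor d p (Sum.elim i j)

/-- Conjugation by a real orthogonal matrix acts on the entries as on a tensor of degree `2t`. -/
theorem conjU_complexify_apply (A : OGrp d) (N : TMat d t) (i j : Fin t → Fin d) :
    conjU t (complexify d A) N i j =
      tensorAct A.1 (fun x : Fin t ⊕ Fin t → Fin d => N (fun k => x (Sum.inl k))
        fun k => x (Sum.inr k)) (Sum.elim i j) := by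
  rw [tensorAct, Fintype.sum_equiv (Equiv.sumArrowEquivProdArrow (Fin t) (Fin t) (Fin d)) _
    (fun y : (Fin t → Fin d) × (Fin t → Fin d) =>
      ((∏ k, ((A.1 (i k) (y.1 k) : ℝ) : ℂ)) * ∏ k, ((A.1 (j k) (y.2 k) : ℝ) : ℂ)) * N y.1 y.2)
    (fun x => by rw [Fintype.prod_sum_type]; rfl)]
  rw [Fintype.sum_prod_type_right, conjU_apply, Matrix.mul_apply]
  refine Finset.sum_congr rfl fun j' _ => ?_
  rw [Matrix.mul_apply, Finset.sum_mul]
  refine Finset.sum_congr rfl fun i' _ => ?_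
  have h1 : ∀ i i' : Fin t → Fin d,
      tpow t (complexify d A).1 i i' = ∏ k, ((A.1 (i k) (i' k) : ℝ) : ℂ) := fun _ _ => rfl
  rw [Matrix.conjTranspose_apply, h1, h1]
  simp only [star_prod, Complex.star_def, Complex.conj_ofReal]
  ring

/-- The commutant of the orthogonal group is spanned by Brauer diagrams. -/
theorem mem_span_pairMat (hd : t ≤ d ∨ (t = 3 ∧ d = 2)) {N : TMat d t}
    (hN : ∀ A : OGrp d, conjU t (complexify d A) N = N) :
    N ∈ Submodule.span ℂ (pairMat d t '' (pairings (Fin t ⊕ Fin t) : Set _)) := by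
  have h1 : (fun x : Fin t ⊕ Fin t → Fin d => N (fun k => x (Sum.inl k)) fun k => x (Sum.inr k)) ∈
      invariantTensors (Fin t ⊕ Fin t) d := by
    refine mem_invariantTensors fun A hA i => ?_
    have h2 := conjU_complexify_apply ⟨A, (Matrix.mem_orthogonalGroup_iff (Fin d) ℝ).2 hA⟩ N
      (fun k => i (Sum.inl k)) (fun k => i (Sum.inr k))
    rw [hN] at h2
    have h3 : Sum.elim (fun k => i (Sum.inl k)) (fun k => i (Sum.inr k)) = i := by
      ext k
      rcases k with k | k <;> rfl
    rw [h3] at h2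
    exact h2.symm
  have h2 : invariantTensors (Fin t ⊕ Fin t) d ≤ Submodule.span ℂ
      (pairTensor d '' (pairings (Fin t ⊕ Fin t) : Set (Fin t ⊕ Fin t → Fin t ⊕ Fin t))) := by
    rcases hd with hd | ⟨rfl, rfl⟩
    · exact invariantTensors_le_span (by simp; omega)
    · exact invariantTensors_two_le_span (by simp)
  let f : ((Fin t ⊕ Fin t → Fin d) → ℂ) →ₗ[ℂ] TMat d t :=
    { toFun := fun T => Matrix.of fun i j => T (Sum.elim i j)
      map_add' := fun _ _ => rfl
      map_smul' := fun _ _ => rfl }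
  have h3 := Submodule.mem_map_of_mem (f := f) (h2 h1)
  rw [Submodule.map_span, ← Set.image_comp] at h3
  exact h3

/-- The permutation operators. -/
def permMat (d : ℕ) {t : ℕ} (τ : Equiv.Perm (Fin t)) : TMat d t :=
  Matrix.of fun i j => if ∀ k, i k = j (τ k) then 1 else 0

theorem tpow_submatrix_perm (A : Matrix (Fin d) (Fin d) ℂ) (τ : Equiv.Perm (Fin t)) :
    (tpow t A).submatrix (Equiv.arrowCongr τ.symm (Equiv.refl (Fin d)))
      (Equiv.arrowCongr τ.symm (Equiv.refl (Fin d))) = tpow t A := by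
  ext i j
  simp only [tpow, Matrix.submatrix_apply, Matrix.of_apply]
  exact Equiv.prod_comp τ fun k => A (i k) (j k)

/-- A permutation operator is the identity with its columns permuted, and `(U^{⊗t})†` is unchanged
when rows and columns are permuted together. -/
theorem conjU_permMat (U : UGrp d) (τ : Equiv.Perm (Fin t)) :
    conjU t U (permMat d τ) = permMat d τ := by
  have h1 : permMat d τ =
      (1 : TMat d t).submatrix (Equiv.refl _) (Equiv.arrowCongr τ.symm (Equiv.refl (Fin d))) := by
    ext i j
    simp only [permMat, Matrix.of_apply, Matrix.submatrix_apply, Matrix.one_apply, funext_iff]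
    rfl
  have h2 : tpow t U.1 = (tpow t U.1).submatrix (Equiv.refl _) (Equiv.refl _) := rfl
  have h3 : (tpow t U.1)ᴴ = (tpow t U.1)ᴴ.submatrix
      (Equiv.arrowCongr τ.symm (Equiv.refl (Fin d)))
      (Equiv.arrowCongr τ.symm (Equiv.refl (Fin d))) := by
    rw [← tpow_conjTranspose, tpow_submatrix_perm]
  rw [conjU_apply, h1, h3]
  nth_rw 1 [h2]
  rw [Matrix.submatrix_mul_equiv, Matrix.submatrix_mul_equiv, mul_one, tpow_mul_conjTranspose]

/-- The index of a `t + 1`-fold tensor product, with the factors permuted by `π` and the last one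
split off. -/
def splitLast (d : ℕ) {t : ℕ} (π : Equiv.Perm (Fin (t + 1))) :
    (Fin (t + 1) → Fin d) ≃ (Fin t → Fin d) × Fin d where
  toFun i := (fun k => i (π k.castSucc), i (π (Fin.last t)))
  invFun x := fun k => Fin.snoc (α := fun _ => Fin d) x.1 x.2 (π.symm k)
  left_inv i := by
    have : (Fin.snoc (α := fun _ => Fin d) (fun k => i (π k.castSucc)) (i (π (Fin.last t)))) =
        fun k => i (π k) := by
      funext k
      refine Fin.lastCases ?_ (fun k => ?_) k <;> simp
    funext k
    simp [this]
  right_inv x := by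
    simp

open scoped Kronecker

theorem tpow_succ (π : Equiv.Perm (Fin (t + 1))) (A : Matrix (Fin d) (Fin d) ℂ) :
    tpow (t + 1) A = (tpow t A ⊗ₖ A).submatrix (splitLast d π) (splitLast d π) := by
  ext i j
  simp only [tpow, Matrix.submatrix_apply, Matrix.of_apply, Matrix.kroneckerMap_apply, splitLast,
    Equiv.coe_fn_mk]
  rw [← Equiv.prod_comp π, Fin.prod_univ_castSucc]

/-- The operator `N ⊗ 1`, with the tensor factors of domain and codomain permuted. -/
def lift (π σ : Equiv.Perm (Fin (t + 1))) : TMat d t →ₗ[ℂ] TMat d (t + 1) where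
  toFun N := (N ⊗ₖ (1 : Matrix (Fin d) (Fin d) ℂ)).submatrix (splitLast d π) (splitLast d σ)
  map_add' M N := by
    rw [Matrix.add_kronecker]
    rfl
  map_smul' c M := by
    rw [Matrix.smul_kronecker]
    rfl

theorem lift_apply (π σ : Equiv.Perm (Fin (t + 1))) (N : TMat d t) : lift π σ N =
    (N ⊗ₖ (1 : Matrix (Fin d) (Fin d) ℂ)).submatrix (splitLast d π) (splitLast d σ) := rfl

/-- Rows and columns may be ordered by different permutations because a tensor power looks the same
in every ordering; in the split-off factor `U 1 U† = 1`. -/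
theorem lift_conjU (π σ : Equiv.Perm (Fin (t + 1))) (U : UGrp d) (N : TMat d t) :
    lift π σ (conjU t U N) = conjU (t + 1) U (lift π σ N) := by
  rw [conjU_apply, conjU_apply, tpow_succ π]
  have : ((tpow t U.1 ⊗ₖ U.1).submatrix (splitLast d π) (splitLast d π))ᴴ =
      ((tpow t U.1)ᴴ ⊗ₖ U.1ᴴ).submatrix (splitLast d σ) (splitLast d σ) := by
    rw [← tpow_succ, tpow_succ σ, Matrix.conjTranspose_submatrix, Matrix.conjTranspose_kronecker]
  rw [this, lift_apply, lift_apply, Matrix.submatrix_mul_equiv, Matrix.submatrix_mul_equiv,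
    ← Matrix.mul_kronecker_mul, ← Matrix.mul_kronecker_mul, mul_one,
    ← Matrix.star_eq_conjTranspose U.1, Matrix.mem_unitaryGroup_iff.1 U.2]

theorem lift_injective (hd : 1 ≤ d) (π σ : Equiv.Perm (Fin (t + 1))) :
    Function.Injective (lift π σ : TMat d t →ₗ[ℂ] TMat d (t + 1)) := by
  intro M N h
  ext i j
  have := congrFun (congrFun h ((splitLast d π).symm (i, ⟨0, hd⟩)))
    ((splitLast d σ).symm (j, ⟨0, hd⟩))
  simpa [lift_apply] using this

end Commutant

/-! ### Degree two -/

section Bell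

variable {d : ℕ}

/-- The unnormalized maximally entangled vector. -/
def pairVec (d : ℕ) : (Fin 2 → Fin d) → ℂ := fun i => if i 0 = i 1 then 1 else 0

/-- The operator `d P_t`. -/
def pairF (d : ℕ) : TMat d 2 := Matrix.vecMulVec (pairVec d) (pairVec d)

theorem pairF_apply (i j : Fin 2 → Fin d) :
    pairF d i j = if i 0 = i 1 ∧ j 0 = j 1 then 1 else 0 := by
  simp only [pairF, pairVec, Matrix.vecMulVec_apply, ite_and]
  split_ifs <;> simp

theorem bellProj_eq (hd : 1 ≤ d) : bellProj d = (1 / d : ℂ) • pairF d := by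
  ext i j
  have h : ((Real.sqrt d : ℝ) : ℂ) * ((Real.sqrt d : ℝ) : ℂ) = d := by
    rw [← Complex.ofReal_mul, Real.mul_self_sqrt (Nat.cast_nonneg d)]
    simp
  have hd' : (d : ℂ) ≠ 0 := by
    exact_mod_cast (by omega : d ≠ 0)
  rw [Matrix.smul_apply, pairF_apply]
  simp only [bellProj, bellVec, Matrix.vecMulVec_apply, Pi.star_apply, apply_ite star,
    Complex.star_def, Complex.conj_ofReal, star_zero, ite_and]
  split_ifs <;> simp [← mul_inv, h]

/-- The Bell vector is the vectorized identity, on which `A ⊗ A` acts by congruence. Real orthogonal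
matrices therefore fix it. -/
theorem tpow_two_mulVec_pairVec (A : Matrix (Fin d) (Fin d) ℂ) (i : Fin 2 → Fin d) :
    (tpow 2 A *ᵥ pairVec d) i = (A * Aᵀ) (i 0) (i 1) := by
  rw [Matrix.mulVec, dotProduct, ← (finTwoArrowEquiv (Fin d)).symm.sum_comp, Fintype.sum_prod_type,
    Matrix.mul_apply]
  refine Finset.sum_congr rfl fun x _ => ?_
  simp [pairVec, tpow]

theorem trace_pairF : (pairF d).trace = d := by
  rw [Matrix.trace, ← (finTwoArrowEquiv (Fin d)).symm.sum_comp, Fintype.sum_prod_type]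
  simp [pairF_apply]

theorem pairF_mul_pairF : pairF d * pairF d = (d : ℂ) • pairF d := by
  have : pairVec d ⬝ᵥ pairVec d = d := by
    rw [← trace_pairF, pairF, Matrix.trace_vecMulVec]
  rw [pairF, Matrix.vecMulVec_mul_vecMulVec, this]
  ext i j
  simp [Matrix.vecMulVec_apply, mul_left_comm]

/-- The swap of the two tensor factors. -/
def swapMat (d : ℕ) : TMat d 2 := permMat d (Equiv.swap 0 1)

theorem swapMat_apply (i j : Fin 2 → Fin d) :
    swapMat d i j = if i 0 = j 1 ∧ i 1 = j 0 then 1 else 0 := by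
  simp [swapMat, permMat, Fin.forall_fin_two]

theorem trace_swapMat : (swapMat d).trace = d := by
  rw [← trace_pairF, Matrix.trace, Matrix.trace]
  refine Finset.sum_congr rfl fun i _ => ?_
  rw [Matrix.diag_apply, Matrix.diag_apply, swapMat_apply, pairF_apply]
  refine if_congr ?_ rfl rfl
  rw [eq_comm (a := i 1)]

theorem swapMat_eq_submatrix : swapMat d = (1 : TMat d 2).submatrix (Equiv.refl _)
    (Equiv.arrowCongr (Equiv.swap 0 1) (Equiv.refl (Fin d))) := by
  ext i j
  simp [swapMat_apply, Matrix.one_apply, funext_iff, Fin.forall_fin_two]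

theorem mul_swapMat (M : TMat d 2) : M * swapMat d =
    M.submatrix (Equiv.refl _) (Equiv.arrowCongr (Equiv.swap 0 1) (Equiv.refl (Fin d))) := by
  rw [swapMat_eq_submatrix]
  exact (Matrix.submatrix_mul_equiv M 1 (Equiv.refl _) (Equiv.refl _) _).trans (by rw [mul_one])

theorem pairF_mul_swapMat : pairF d * swapMat d = pairF d := by
  rw [mul_swapMat]
  ext i j
  simp only [Matrix.submatrix_apply, pairF_apply]
  refine if_congr (and_congr Iff.rfl ?_) rfl rfl
  exact eq_comm

theorem swapMat_mul_pairF : swapMat d * pairF d = pairF d := by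
  have h : swapMat d = (1 : TMat d 2).submatrix
      (Equiv.arrowCongr (Equiv.swap 0 1) (Equiv.refl (Fin d))) (Equiv.refl _) := by
    ext i j
    simp [swapMat_apply, Matrix.one_apply, funext_iff, Fin.forall_fin_two, and_comm]
  rw [h]
  refine (Matrix.submatrix_mul_equiv 1 (pairF d) _ (Equiv.refl _) (Equiv.refl _)).trans ?_
  rw [one_mul]
  ext i j
  simp only [Matrix.submatrix_apply, pairF_apply]
  refine if_congr (and_congr ?_ Iff.rfl) rfl rfl
  exact eq_comm

theorem conjU_swapMat (U : UGrp d) : conjU 2 U (swapMat d) = swapMat d := conjU_permMat U _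

theorem swapMat_mul_swapMat : swapMat d * swapMat d = 1 := by
  rw [mul_swapMat]
  ext i j
  simp [swapMat_apply, Matrix.one_apply, funext_iff, Fin.forall_fin_two]

theorem conjU_complexify_pairF (A : OGrp d) : conjU 2 (complexify d A) (pairF d) = pairF d := by
  have h1 : tpow 2 (complexify d A).1 *ᵥ pairVec d = pairVec d := by
    funext i
    have h2 := congrArg (fun B => Complex.ofRealHom.mapMatrix B)
      ((Matrix.mem_orthogonalGroup_iff (Fin d) ℝ).1 A.2)
    simp only [map_mul, map_one] at h2
    have h3 : (complexify d A).1 * (complexify d A).1ᵀ = 1 := h2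
    rw [tpow_two_mulVec_pairVec, h3, Matrix.one_apply]
    rfl
  have h4 : star (pairVec d) = pairVec d := by
    funext i
    simp [pairVec, apply_ite]
  rw [conjU_apply, pairF, Matrix.mul_vecMulVec, Matrix.vecMulVec_mul, h1]
  congr 1
  have := Matrix.star_mulVec (tpow 2 (complexify d A).1) (pairVec d)
  rw [h1, h4] at this
  exact this.symm

/-- The partner of `inl 0` determines the pairing: `inl 1` gives `pairF`, `inr 0` the identity, `inr
1` the swap. -/
theorem pairMat_two_mem_span {p : Fin 2 ⊕ Fin 2 → Fin 2 ⊕ Fin 2}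
    (hp : p ∈ pairings (Fin 2 ⊕ Fin 2)) :
    pairMat d 2 p ∈ Submodule.span ℂ {1, swapMat d, pairF d} := by
  rw [mem_pairings] at hp
  have hcases : ∀ x : Fin 2 ⊕ Fin 2, x = Sum.inl 0 ∨ x = Sum.inl 1 ∨ x = Sum.inr 0 ∨
      x = Sum.inr 1 := by decide
  have hinj : ∀ x y, p x = p y → x = y := fun x y h => by rw [← (hp x).1, h, (hp y).1]
  have key : pairMat d 2 p = 1 ∨ pairMat d 2 p = swapMat d ∨ pairMat d 2 p = pairF d := by
    rcases hcases (p (Sum.inl 0)) with h | h | h | h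
    · exact absurd h (hp _).2
    · have h' := (hp (Sum.inl 0)).1
      rw [h] at h'
      have h2 : p (Sum.inr 0) = Sum.inr 1 := by
        rcases hcases (p (Sum.inr 0)) with h3 | h3 | h3 | h3
        · exact absurd (hinj _ _ (h3.trans h'.symm)) (by decide)
        · exact absurd (hinj _ _ (h3.trans h.symm)) (by decide)
        · exact absurd h3 (hp _).2
        · exact h3
      have h2' := (hp (Sum.inr 0)).1
      rw [h2] at h2'
      refine Or.inr (Or.inr ?_)
      ext i j
      rw [pairF_apply]
      refine if_congr ?_ rfl rfl
      simp [Sum.forall, Fin.forall_fin_two, h, h', h2, h2', eq_comm]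
    · have h' := (hp (Sum.inl 0)).1
      rw [h] at h'
      have h2 : p (Sum.inl 1) = Sum.inr 1 := by
        rcases hcases (p (Sum.inl 1)) with h3 | h3 | h3 | h3
        · exact absurd (hinj _ _ (h3.trans h'.symm)) (by decide)
        · exact absurd h3 (hp _).2
        · exact absurd (hinj _ _ (h3.trans h.symm)) (by decide)
        · exact h3
      have h2' := (hp (Sum.inl 1)).1
      rw [h2] at h2'
      refine Or.inl ?_
      ext i j
      rw [Matrix.one_apply]
      refine if_congr ?_ rfl rfl
      simp [Sum.forall, Fin.forall_fin_two, funext_iff, h, h', h2, h2', eq_comm]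
    · have h' := (hp (Sum.inl 0)).1
      rw [h] at h'
      have h2 : p (Sum.inl 1) = Sum.inr 0 := by
        rcases hcases (p (Sum.inl 1)) with h3 | h3 | h3 | h3
        · exact absurd (hinj _ _ (h3.trans h'.symm)) (by decide)
        · exact absurd h3 (hp _).2
        · exact h3
        · exact absurd (hinj _ _ (h3.trans h.symm)) (by decide)
      have h2' := (hp (Sum.inl 1)).1
      rw [h2] at h2'
      refine Or.inr (Or.inl ?_)
      ext i j
      rw [swapMat_apply]
      refine if_congr ?_ rfl rfl
      simp [Sum.forall, Fin.forall_fin_two, h, h', h2, h2', eq_comm]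
      tauto
  rcases key with h | h | h <;> rw [h] <;> apply Submodule.subset_span <;> simp

/-- The twirl of the rotated maximally entangled state is the normalized projection onto the
symmetric subspace. -/
theorem rotatedTwirl_pairF (hd : 2 ≤ d) {W : UGrp d} (hW : HasBellOverlap W) :
    rotatedTwirl 2 W (pairF d) = (1 / (d + 1) : ℂ) • (1 + swapMat d) := by
  set X := conjU 2 W⁻¹ (pairF d) with hX
  set Q := orthogonalTwirl d 2 X with hQ
  have hd0 : (d : ℂ) ≠ 0 := by exact_mod_cast (by omega : d ≠ 0)
  have hd1 : (d : ℂ) + 1 ≠ 0 := by exact_mod_cast (by omega : d + 1 ≠ 0)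
  have hXS : X * swapMat d = X := by
    rw [hX, ← conjU_swapMat W⁻¹, ← conjU_mul_matrix, pairF_mul_swapMat]
  have hQS : Q * swapMat d = Q := by
    have := map_twirl_eq_of_forall (complexify d)
      (LinearMap.mulRight ℂ (swapMat d) - LinearMap.id) X 0 fun A => by
        rw [LinearMap.sub_apply, LinearMap.mulRight_apply, LinearMap.id_apply]
        nth_rw 1 [← conjU_swapMat (complexify d A)]
        rw [← conjU_mul_matrix, hXS, sub_self]
    exact sub_eq_zero.1 this
  have htr : Q.trace = d := by
    rw [← trace_pairF, ← trace_conjU W⁻¹ (pairF d)]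
    exact map_twirl_eq_of_forall (complexify d) (Matrix.traceLinearMap _ ℂ ℂ) X _ fun A =>
      trace_conjU _ _
  -- The overlap condition on `W` enters here, multiplied by `d²` because `pairF` is `d P_t`.
  have hover : (X * pairF d).trace = 2 * d / (d + 1) := by
    have h1 : (conjU 2 W (bellProj d) * bellProj d).trace = 2 / (d * (d + 1)) := hW
    rw [bellProj_eq (by omega), map_smul, smul_mul_smul_comm, Matrix.trace_smul, smul_eq_mul] at h1
    rw [← trace_conjU W, conjU_mul_matrix, hX, conjU_self_inv, Matrix.trace_mul_comm]
    field_simp at h1 ⊢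
    linear_combination h1
  have htrF : (Q * pairF d).trace = 2 * d / (d + 1) := by
    rw [← hover]
    exact map_twirl_eq_of_forall (complexify d)
      (Matrix.traceLinearMap _ ℂ ℂ ∘ₗ LinearMap.mulRight ℂ (pairF d)) X _ fun A => by
        simp only [LinearMap.comp_apply, LinearMap.mulRight_apply, Matrix.traceLinearMap_apply]
        nth_rw 1 [← conjU_complexify_pairF A]
        rw [← conjU_mul_matrix, trace_conjU]
  have hspan : Q ∈ Submodule.span ℂ {1, swapMat d, pairF d} := by
    refine Submodule.span_le.2 ?_ (mem_span_pairMat (Or.inl hd) fun A => conjU_twirl _ A X)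
    rintro _ ⟨p, hp, rfl⟩
    exact pairMat_two_mem_span hp
  rw [Submodule.mem_span_triple] at hspan
  obtain ⟨x, y, z, hxyz⟩ := hspan
  -- Averaging `Q` with `Q * swapMat d = Q` equalizes the coefficients of the identity and the swap,
  -- leaving two unknowns for the trace and the overlap with `pairF`.
  have hQ' : Q = ((x + y) / 2) • (1 + swapMat d) + z • pairF d := by
    have h1 : Q = (1 / 2 : ℂ) • (Q + Q * swapMat d) := by
      rw [hQS]
      module
    rw [h1, ← hxyz, add_mul, add_mul, smul_mul_assoc, smul_mul_assoc, smul_mul_assoc, one_mul,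
      swapMat_mul_swapMat, pairF_mul_swapMat]
    module
  generalize (x + y) / 2 = a at hQ'
  have h1 : a * (d ^ 2 + d) + z * d = d := by
    have h3 := htr
    rw [hQ'] at h3
    simp [Matrix.trace_add, Matrix.trace_smul, trace_swapMat, trace_pairF] at h3
    linear_combination h3
  have h2 : a * (2 * d) + z * d ^ 2 = 2 * d / (d + 1) := by
    rw [← htrF, hQ', add_mul, smul_mul_assoc, smul_mul_assoc, add_mul, one_mul, swapMat_mul_pairF,
      pairF_mul_pairF]
    simp only [Matrix.trace_add, Matrix.trace_smul, trace_pairF, smul_eq_mul]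
    ring
  have h3 : a * (d + 1) + z = 1 := mul_left_cancel₀ hd0 (by linear_combination h1)
  have h4 : 2 * a + z * d = 2 / (d + 1) := mul_left_cancel₀ hd0 (by linear_combination h2)
  -- Up to sign this is the determinant of the two equations; it would vanish at `d = 1`.
  have h5 : (2 : ℂ) - d * (d + 1) ≠ 0 := by
    rw [sub_ne_zero]
    exact_mod_cast (by nlinarith : 2 ≠ d * (d + 1))
  have ha : a = 1 / (d + 1) := by
    rw [eq_div_iff hd1] at h4 ⊢
    refine mul_right_cancel₀ h5 ?_
    linear_combination h4 - (d : ℂ) * (d + 1) * h3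
  have hz : z = 0 := by
    rw [ha] at h3
    field_simp at h3
    linear_combination h3
  rw [rotatedTwirl_apply, ← hX, ← hQ, hQ', ha, hz, zero_smul, add_zero, map_smul, map_add,
    conjU_id, conjU_swapMat]

end Bell

/-! ### The product of the twirls over the orthogonal group and its rotation -/

section ProductTwirl

variable {d t : ℕ}

theorem conjU_eq_self_of_dim_one (U : UGrp 1) (M : TMat 1 t) : conjU t U M = M := by
  have h : M = M (fun _ => 0) (fun _ => 0) • (1 : TMat 1 t) := by
    ext i j
    rw [Subsingleton.elim i fun _ => 0, Subsingleton.elim j fun _ => 0]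
    simp
  rw [h, map_smul, conjU_id]

/-- A Brauer diagram in degree three is a permutation or factors through a contraction. -/
theorem pairMat_three {p : Fin 3 ⊕ Fin 3 → Fin 3 ⊕ Fin 3} (hp : p ∈ pairings (Fin 3 ⊕ Fin 3)) :
    (∃ τ, pairMat d 3 p = permMat d τ) ∨ ∃ π σ, pairMat d 3 p = lift π σ (pairF d) := by
  rw [mem_pairings] at hp
  have hinj : ∀ x y, p x = p y → x = y := fun x y h => by rw [← (hp x).1, h, (hp y).1]
  by_cases h : ∃ x y, p (Sum.inl x) = Sum.inl y
  · obtain ⟨x, y, hxy⟩ := h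
    have hne : x ≠ y := by
      rintro rfl
      exact (hp _).2 hxy
    -- Rows are relabelled so that the contraction joins factors 0 and 1; the third row point must
    -- then cross to a column point, which `σ` labels 2, and the other two column points are joined.
    obtain ⟨π, rfl, rfl⟩ : ∃ π : Equiv.Perm (Fin 3), π 0 = x ∧ π 1 = y := by
      clear hxy
      revert x y
      decide
    have hyx : p (Sum.inl (π 1)) = Sum.inl (π 0) := by rw [← hxy, (hp _).1]
    obtain ⟨w, hw⟩ : ∃ w, p (Sum.inl (π 2)) = Sum.inr w := by
      rcases hq : p (Sum.inl (π 2)) with q | q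
      · obtain ⟨q, rfl⟩ := π.surjective q
        fin_cases q
        · exact absurd (π.injective (Sum.inl_injective (hinj _ _ (hq.trans hyx.symm)))) (by decide)
        · exact absurd (π.injective (Sum.inl_injective (hinj _ _ (hq.trans hxy.symm)))) (by decide)
        · exact absurd hq (hp _).2
      · exact ⟨q, rfl⟩
    obtain ⟨σ, rfl⟩ : ∃ σ : Equiv.Perm (Fin 3), σ 2 = w := ⟨Equiv.swap 2 w, by simp⟩
    have hw' : p (Sum.inr (σ 2)) = Sum.inl (π 2) := by rw [← hw, (hp _).1]
    have huv : p (Sum.inr (σ 0)) = Sum.inr (σ 1) := by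
      rcases hq : p (Sum.inr (σ 0)) with q | q
      · obtain ⟨q, rfl⟩ := π.surjective q
        fin_cases q
        · exact absurd (hinj _ _ (hq.trans hyx.symm)) (by simp)
        · exact absurd (hinj _ _ (hq.trans hxy.symm)) (by simp)
        · exact absurd (σ.injective (Sum.inr_injective (hinj _ _ (hq.trans hw'.symm)))) (by decide)
      · obtain ⟨q, rfl⟩ := σ.surjective q
        fin_cases q
        · exact absurd hq (hp _).2
        · rfl
        · exact absurd (hinj _ _ (hq.trans hw.symm)) (by simp)
    have hvu : p (Sum.inr (σ 1)) = Sum.inr (σ 0) := by rw [← huv, (hp _).1]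
    refine Or.inr ⟨π, σ, ?_⟩
    ext i j
    rw [lift_apply, Matrix.submatrix_apply, Matrix.kroneckerMap_apply, pairF_apply,
      Matrix.one_apply, ite_zero_mul_ite_zero, one_mul]
    refine if_congr ?_ rfl rfl
    have e1 : ∀ (P : Fin 3 ⊕ Fin 3 → Prop), (∀ k, P k) ↔
        (∀ k, P (Sum.inl (π k))) ∧ ∀ k, P (Sum.inr (σ k)) := fun P => by
      rw [Sum.forall, π.forall_congr_right (q := fun k => P (Sum.inl k)),
        σ.forall_congr_right (q := fun k => P (Sum.inr k))]
    rw [e1]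
    have hlast : Fin.last 2 = 2 := rfl
    have hc0 : (0 : Fin 2).castSucc = 0 := rfl
    have hc1 : (1 : Fin 2).castSucc = 1 := rfl
    simp only [Fin.forall_fin_succ, IsEmpty.forall_iff, and_true,
      splitLast, Equiv.coe_fn_mk, hlast, hc0, hc1]
    simp only [Fin.succ_zero_eq_one, Fin.succ_one_eq_two, hxy, hyx, hw, hw', huv, hvu,
      Sum.elim_inl, Sum.elim_inr]
    constructor
    · rintro ⟨⟨h1, -, h2⟩, h3, -, -⟩
      exact ⟨⟨h1.symm, h3.symm⟩, h2.symm⟩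
    · rintro ⟨⟨h1, h3⟩, h2⟩
      exact ⟨⟨h1.symm, h1, h2.symm⟩, h3.symm, h3, h2⟩
  · have h' : ∀ x, ∃ y, p (Sum.inl x) = Sum.inr y := by
      intro x
      rcases hq : p (Sum.inl x) with q | q
      · exact absurd ⟨x, q, hq⟩ h
      · exact ⟨q, rfl⟩
    choose f hf using h'
    have hfi : Function.Injective f := fun x y hxy =>
      Sum.inl_injective (hinj _ _ (by rw [hf, hf, hxy]))
    let τ : Equiv.Perm (Fin 3) := Equiv.ofBijective f (Finite.injective_iff_bijective.1 hfi)
    have hτ : ∀ x, p (Sum.inl x) = Sum.inr (τ x) := hf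
    have hτ' : ∀ x, p (Sum.inr (τ x)) = Sum.inl x := fun x => by rw [← hτ, (hp _).1]
    refine Or.inl ⟨τ, ?_⟩
    ext i j
    refine if_congr ?_ rfl rfl
    rw [Sum.forall]
    simp only [hτ, Sum.elim_inl, Sum.elim_inr]
    constructor
    · exact fun h k => (h.1 k).symm
    · refine fun h => ⟨fun k => (h k).symm, fun k => ?_⟩
      obtain ⟨k, rfl⟩ := τ.surjective k
      rw [hτ', Sum.elim_inl, h k]

/-- Permutations already commute with all unitaries. A contraction diagram is a lift of `pairF`,
whose rotated twirl is a combination of the identity and the swap. -/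
theorem conjU_rotatedTwirl_pairMat (hd : 2 ≤ d) {W : UGrp d} (hW : HasBellOverlap W)
    {p : Fin 3 ⊕ Fin 3 → Fin 3 ⊕ Fin 3} (hp : p ∈ pairings (Fin 3 ⊕ Fin 3)) (U : UGrp d) :
    conjU 3 U (rotatedTwirl 3 W (pairMat d 3 p)) = rotatedTwirl 3 W (pairMat d 3 p) := by
  rcases pairMat_three (d := d) hp with ⟨τ, h⟩ | ⟨π, σ, h⟩
  · rw [h, rotatedTwirl_eq_self W _ fun V => conjU_permMat V τ, conjU_permMat]
  · rw [h, ← rotatedTwirl_comm _ (lift_conjU π σ), ← lift_conjU, rotatedTwirl_pairF hd hW, map_smul,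
      map_add, conjU_id, conjU_swapMat]

theorem rotatedTwirl_comp_orthogonalTwirl_three (hd : 1 ≤ d) {W : UGrp d}
    (hW : HasBellOverlap W) :
    rotatedTwirl 3 W ∘ₗ orthogonalTwirl d 3 = unitaryTwirl d 3 := by
  refine rotatedTwirl_comp_orthogonalTwirl_of_fixed W fun U M => ?_
  rcases (by omega : d = 1 ∨ 2 ≤ d) with rfl | hd
  · exact conjU_eq_self_of_dim_one U _
  have hspan := mem_span_pairMat (by omega : 3 ≤ d ∨ (3 = 3 ∧ d = 2))
    fun A => conjU_twirl (complexify d) A M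
  have hle : Submodule.span ℂ (pairMat d 3 '' (pairings (Fin 3 ⊕ Fin 3) : Set _)) ≤
      LinearMap.ker (conjU 3 U ∘ₗ rotatedTwirl 3 W - rotatedTwirl 3 W) := by
    rw [Submodule.span_le]
    rintro _ ⟨p, hp, rfl⟩
    exact sub_eq_zero.2 (conjU_rotatedTwirl_pairMat hd hW hp U)
  exact sub_eq_zero.1 (hle hspan)

/-- Tensoring with the identity intertwines all three twirls and is injective. -/
theorem rotatedTwirl_comp_orthogonalTwirl_of_succ (hd : 1 ≤ d) {W : UGrp d}
    (h : rotatedTwirl (t + 1) W ∘ₗ orthogonalTwirl d (t + 1) = unitaryTwirl d (t + 1)) :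
    rotatedTwirl t W ∘ₗ orthogonalTwirl d t = unitaryTwirl d t := by
  ext1 M
  apply lift_injective hd 1 1
  have h1 := LinearMap.congr_fun h (lift 1 1 M)
  rw [LinearMap.comp_apply] at h1 ⊢
  rw [rotatedTwirl_comm _ (lift_conjU 1 1), orthogonalTwirl, twirl_comm _ _ (lift_conjU 1 1),
    unitaryTwirl, twirl_comm _ _ (lift_conjU 1 1)]
  exact h1

theorem rotatedTwirl_comp_orthogonalTwirl (hd : 1 ≤ d) {W : UGrp d} (hW : HasBellOverlap W)
    (ht : t ≤ 3) : rotatedTwirl t W ∘ₗ orthogonalTwirl d t = unitaryTwirl d t := by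
  have h3 := rotatedTwirl_comp_orthogonalTwirl_three hd hW
  have h2 := rotatedTwirl_comp_orthogonalTwirl_of_succ hd h3
  have h1 := rotatedTwirl_comp_orthogonalTwirl_of_succ hd h2
  have h0 := rotatedTwirl_comp_orthogonalTwirl_of_succ hd h1
  interval_cases t
  exacts [h0, h1, h2, h3]

end ProductTwirl

/-! ### The diagonal rotating unitary -/

section Diagonal

variable {d : ℕ}

theorem continuous_qFun : Continuous (qFun d) := by
  unfold qFun omegaPow
  fun_prop

theorem qFun_zero : qFun d 0 = (d : ℝ) ^ 2 := by
  simp [qFun, omegaPow]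

/-- The summands are the powers of a primitive `d`-th root of unity. -/
theorem qFun_one (hd : 2 ≤ d) : qFun d 1 = 0 := by
  have h := (Complex.isPrimitiveRoot_exp d (by omega)).geom_sum_eq_zero (by omega)
  have h1 : ∑ j : Fin d, omegaPow d (2 * 1 * (j : ℕ)) = 0 := by
    rw [← h, ← Fin.sum_univ_eq_sum_range (fun j => Complex.exp (2 * Real.pi * Complex.I / d) ^ j)]
    refine Finset.sum_congr rfl fun j _ => ?_
    rw [omegaPow, ← Complex.exp_nat_mul]
    congr 1
    have hd0 : (d : ℂ) ≠ 0 := by exact_mod_cast (by omega : d ≠ 0)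
    push_cast
    field_simp
  rw [qFun, h1]
  simp

theorem exists_qFun_eq (hd : 1 ≤ d) :
    ∃ α ∈ Set.Icc (0 : ℝ) 1, qFun d α = 2 * (d : ℝ) / ((d : ℝ) + 1) := by
  -- For `d = 1` the sum has one term and no zero at `α = 1`, but the target is `1 = qFun 1 0`.
  -- Otherwise the target lies between `0` and `d²`.
  rcases (by omega : d = 1 ∨ 2 ≤ d) with rfl | hd2
  · refine ⟨0, by simp, ?_⟩
    rw [qFun_zero]
    norm_num
  · have hd' : (2 : ℝ) ≤ d := by exact_mod_cast hd2
    have hmem : 2 * (d : ℝ) / ((d : ℝ) + 1) ∈ Set.Icc (qFun d 1) (qFun d 0) := by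
      rw [qFun_zero, qFun_one hd2]
      refine ⟨by positivity, ?_⟩
      rw [div_le_iff₀ (by positivity)]
      nlinarith [mul_nonneg (by linarith : (0 : ℝ) ≤ d) (by nlinarith : (0 : ℝ) ≤ d * (d + 1) - 2)]
    exact intermediate_value_Icc' zero_le_one (continuous_qFun.continuousOn) hmem

/-- With a rank-one projection the trace is the squared modulus of one matrix element of `W ⊗ W`.
For diagonal `W` that element is a sum of squared entries, hence the doubled exponent in `qFun`. -/
theorem hasBellOverlap_diagW (hd : 1 ≤ d) {α : ℝ}
    (hα : qFun d α = 2 * (d : ℝ) / ((d : ℝ) + 1)) : HasBellOverlap (diagW d α) := by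
  have hd0 : (d : ℂ) ≠ 0 := by exact_mod_cast (by omega : d ≠ 0)
  set A := tpow 2 (diagW d α).1 with hA
  have h1 : pairVec d ⬝ᵥ (A *ᵥ pairVec d) = ∑ j : Fin d, omegaPow d (2 * α * (j : ℕ)) := by
    rw [dotProduct, ← (finTwoArrowEquiv (Fin d)).symm.sum_comp, Fintype.sum_prod_type]
    refine Finset.sum_congr rfl fun j _ => ?_
    rw [Finset.sum_eq_single j]
    · rw [hA, tpow_two_mulVec_pairVec]
      simp [pairVec, diagW, omegaPow, ← Complex.exp_add]
      ring_nf
    · intro k _ hk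
      simp [pairVec, hk.symm]
    · simp
  have hstar : star (pairVec d) = pairVec d := by
    funext i
    simp [pairVec, apply_ite]
  have h2 : (A * pairF d * Aᴴ * pairF d).trace = ((qFun d α : ℝ) : ℂ) := by
    have h3 : pairVec d ᵥ* Aᴴ = star (A *ᵥ pairVec d) := by
      rw [Matrix.star_mulVec, hstar]
    have h4 : star (A *ᵥ pairVec d) ⬝ᵥ pairVec d = star (pairVec d ⬝ᵥ (A *ᵥ pairVec d)) := by
      rw [← Matrix.star_dotProduct_star, hstar]
    have h5 : A * pairF d * Aᴴ = Matrix.vecMulVec (A *ᵥ pairVec d) (star (A *ᵥ pairVec d)) := by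
      rw [pairF, Matrix.mul_vecMulVec, Matrix.vecMulVec_mul, h3]
    rw [h5, pairF, Matrix.vecMulVec_mul_vecMulVec, Matrix.trace_vecMulVec, h4, dotProduct_smul,
      dotProduct_comm (A *ᵥ _), h1, qFun, smul_eq_mul, Complex.star_def, Complex.conj_mul']
    push_cast
    rfl
  unfold HasBellOverlap
  change (A * bellProj d * Aᴴ * bellProj d).trace = _
  rw [bellProj_eq hd]
  simp only [Matrix.mul_smul, Matrix.smul_mul, Matrix.trace_smul, h2, hα, smul_eq_mul]
  have hd1 : (d : ℂ) + 1 ≠ 0 := by exact_mod_cast (by omega : d + 1 ≠ 0)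
  push_cast
  field_simp

end Diagonal

end OrthoDesign

end

theorem mainTheorem4 (d : ℕ) (hd : 1 ≤ d) :
    (∃ α ∈ Set.Icc (0 : ℝ) 1, OrthoDesign.qFun d α = 2 * (d : ℝ) / ((d : ℝ) + 1)) ∧
    (∀ α : ℝ, OrthoDesign.qFun d α = 2 * (d : ℝ) / ((d : ℝ) + 1) →
      OrthoDesign.HasBellOverlap (OrthoDesign.diagW d α)) ∧
    (∀ W : OrthoDesign.UGrp d, OrthoDesign.HasBellOverlap W →
      ∀ (t : ℕ) (_ : t ≤ 3) (ε : ℝ) (_ : 0 < ε)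
        (V : Finset (OrthoDesign.UGrp d)) (w : OrthoDesign.UGrp d → ℝ),
        OrthoDesign.IsApproxOrthogonalDesign t ε V w →
        OrthoDesign.IsApproxUnitaryDesign t (2 * ε + ε ^ 2)
          (OrthoDesign.mulSet (OrthoDesign.conjSet W V) V)
          (OrthoDesign.mulWeight (OrthoDesign.conjSet W V) V (OrthoDesign.conjWeight W w) w)) :=
  ⟨OrthoDesign.exists_qFun_eq hd, fun _ hα => OrthoDesign.hasBellOverlap_diagW hd hα,
    fun _ hW _ ht _ hε _ _ hV =>
      hV.mul_conj hε (OrthoDesign.rotatedTwirl_comp_orthogonalTwirl hd hW ht)⟩
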